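/- Let $a_1<0<a_2$ and $\delta>0$, and put $\Omega=(a_1,a_2)$ and $\Omega_I=(a_1-\delta,a_1]\cup[a_2,a_2+\delta)$. For a kernel $K:\mathbb{R}\to\mathbb{R}$ define $$Lu(x)=\int_{\Omega\cup\Omega_I}(u(y)-u(x))\,K(|x-y|)\,dy .$$ Assume the following about $K$. (A1) $K$ is even and nonnegative, $K(z)=0$ for $|z|\ge\delta$, and $K\in L^1(\mathbb{R})$. (A2) $K$ is $C^\infty$ on $(-\delta,0)$ and on $(0,\delta)$, and its restriction to $(-\delta,0)\cup(0,\delta)$ extends continuously to $[-\delta,0)\cup(0,\delta]$; that is, $K$ has finite limits at $\pm\delta$ from inside $(-\delta,\delta)$. (Jumps of $K$ at $\pm\delta$ are allowed.) In addition, $K\in L^2(\mathbb{R})$, and $K$ is singular at the origin: $K(z)\to\infty$ as $z\to0$, $z\neq0$. A function $g$ satisfies Assumption (B) if it has a jump discontinuity at $0$ (finite one-sided limits $g(0^-)\ne g(0^+)$), is bounded on $(a_1,a_2)$, and, for some integer $N\ge1$, is $C^N$ on $(a_1,0)$ and on $(0,a_2)$ with $g^{(j)}$ bounded on $(a_1,0)\cup(0,a_2)$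 for $1\le j\le N$. We write $|v'(0^\pm)|=\infty$ if $v$ is differentiable at every $x\ne0$ sufficiently close to $0$, and $|v'(x)|\to\infty$ as $x\to0^-$ and as $x\to0^+$. **Theorem.** 1. Suppose that $f$ satisfies Assumption (B) and $b\in W^{1,2}(\Omega_I)$ (that is, $W^{1,2}$ of the interior of $\Omega_I$). Let $u\in L^2(\Omega\cup\Omega_I)$ solve $Lu=f$ a.e. in $\Omega$ and $u=b$ a.e. in $\Omega_I$. Then $u$ (after modification on a null set) satisfies $|u'(0^\pm)|=\infty$. 2. Suppose that $u:\Omega\cup\Omega_I\to\mathbb{R}$ satisfies Assumption (B) and $u\in W^{1,2}(\Omega_I)$. Then $f:=Lu$ satisfies $|f'(0^\pm)|=\infty$. -/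

import Mathlib

open MeasureTheory Filter Topology Set
open scoped ContDiff

/-- The domain `Ω = (a₁, a₂)`. -/
def domainΩ (a₁ a₂ : ℝ) : Set ℝ := Ioo a₁ a₂

/-- The collar (interaction region) `Ω_I = (a₁ - δ, a₁] ∪ [a₂, a₂ + δ)`. -/
def collarΩ (a₁ a₂ δ : ℝ) : Set ℝ := Ioc (a₁ - δ) a₁ ∪ Ico a₂ (a₂ + δ)

/-- The nonlocal operator `Lu(x) = ∫_{Ω ∪ Ω_I} (u(y) - u(x)) K(|x - y|) dy`. -/
noncomputable def nonlocalL (a₁ a₂ δ : ℝ) (K u : ℝ → ℝ) (x : ℝ) : ℝ :=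
  ∫ y in domainΩ a₁ a₂ ∪ collarΩ a₁ a₂ δ, (u y - u x) * K |x - y|

/-- Assumption (A1): the kernel is radial, nonnegative, vanishes for `|z| ≥ δ`, and is in `L¹(ℝ)`. -/
structure KernelA1 (δ : ℝ) (K : ℝ → ℝ) : Prop where
  radial : ∀ z, K (-z) = K z
  nonneg : ∀ z, 0 ≤ K z
  zero_of_le : ∀ z, δ ≤ |z| → K z = 0
  integrable : Integrable K volume

/-- Assumption (A2): the kernel is smooth on `(-δ, 0)` and on `(0, δ)`, and extends continuously
from there to `[-δ, 0) ∪ (0, δ]`, that is, has finite limits at `±δ` from inside. (The kernel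
itself is zero at `±δ`, so these limits may differ from its values there: jumps at `±δ` are
allowed.) -/
structure KernelA2 (δ : ℝ) (K : ℝ → ℝ) : Prop where
  smooth_neg : ContDiffOn ℝ ∞ K (Ioo (-δ) 0)
  smooth_pos : ContDiffOn ℝ ∞ K (Ioo 0 δ)
  limit_neg : ∃ l : ℝ, Tendsto K (𝓝[>] (-δ)) (𝓝 l)
  limit_pos : ∃ l : ℝ, Tendsto K (𝓝[<] δ) (𝓝 l)

/-- The kernel is singular at the origin: `K(0^±) = ∞`. -/
def SingularAtOrigin (K : ℝ → ℝ) : Prop := Tendsto K (𝓝[≠] 0) atTop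

/-- `f` has a jump discontinuity at `0`: the one-sided limits exist, are finite, and differ. -/
def HasJumpAtZero (f : ℝ → ℝ) : Prop :=
  ∃ l r : ℝ, l ≠ r ∧ Tendsto f (𝓝[<] 0) (𝓝 l) ∧ Tendsto f (𝓝[>] 0) (𝓝 r)

/-- Assumption (B) on `(a₁, a₂)`: `f` has a jump discontinuity at `0`, and for some `N ≥ 1` it is
`C^N` on `(a₁, 0)` and on `(0, a₂)`, with `f` and its derivatives of orders `1, …, N` bounded. -/
def AssumptionB (a₁ a₂ : ℝ) (f : ℝ → ℝ) : Prop :=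
  HasJumpAtZero f ∧
  (∃ C : ℝ, ∀ x ∈ Ioo a₁ a₂, |f x| ≤ C) ∧
  ∃ N : ℕ, 1 ≤ N ∧ ContDiffOn ℝ N f (Ioo a₁ 0) ∧ ContDiffOn ℝ N f (Ioo 0 a₂) ∧
    ∀ j : ℕ, 1 ≤ j → j ≤ N → ∃ C : ℝ, ∀ x ∈ Ioo a₁ a₂, x ≠ 0 → |iteratedDeriv j f x| ≤ C

/-- `g` is a weak derivative of `f` on the open set `U ⊆ ℝ`. -/
def IsWeakDeriv (U : Set ℝ) (f g : ℝ → ℝ) : Prop :=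
  ∀ φ : ℝ → ℝ, ContDiff ℝ ∞ φ → HasCompactSupport φ → tsupport φ ⊆ U →
    ∫ x in U, f x * deriv φ x = - ∫ x in U, g x * φ x

/-- The Sobolev space `W^{1,2}(U)` of an open set `U ⊆ ℝ`. -/
def MemW12 (U : Set ℝ) (f : ℝ → ℝ) : Prop :=
  MemLp f 2 (volume.restrict U) ∧
    ∃ g : ℝ → ℝ, MemLp g 2 (volume.restrict U) ∧ IsWeakDeriv U f g

/-- `b ∈ W^{1,2}(Ω_I)`: the Sobolev space of the interior `(a₁ - δ, a₁) ∪ (a₂, a₂ + δ)` of `Ω_I`,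
which differs from `Ω_I` by two points. -/
def MemW12Collar (a₁ a₂ δ : ℝ) (b : ℝ → ℝ) : Prop :=
  MemW12 (Ioo (a₁ - δ) a₁ ∪ Ioo a₂ (a₂ + δ)) b

/-- `u ∈ L²(Ω ∪ Ω_I)` solves `Lu = f` in `Ω`, `u = b` in `Ω_I` (almost everywhere). -/
structure IsSolution (a₁ a₂ δ : ℝ) (K f b u : ℝ → ℝ) : Prop where
  memLp : MemLp u 2 (volume.restrict (domainΩ a₁ a₂ ∪ collarΩ a₁ a₂ δ))
  eq_source : ∀ᵐ x ∂(volume.restrict (domainΩ a₁ a₂)), nonlocalL a₁ a₂ δ K u x = f x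
  eq_collar : ∀ᵐ x ∂(volume.restrict (collarΩ a₁ a₂ δ)), u x = b x

/-- `|v'(0^±)| = ∞`: on both sides of `0`, `v` is differentiable near `0`, and `|v'(x)| → ∞` as
`x → 0⁻` and as `x → 0⁺`. -/
def DerivBlowsUpAtZero (v : ℝ → ℝ) : Prop :=
  (∀ᶠ x in 𝓝[≠] (0 : ℝ), DifferentiableAt ℝ v x) ∧
  Tendsto (fun x => |deriv v x|) (𝓝[<] 0) atTop ∧
  Tendsto (fun x => |deriv v x|) (𝓝[>] 0) atTop

/-!
Write `β = ∫ K`, which is positive because `K → ∞` at `0`. For `x ∈ Ω` the kernel `K(x - ·)` lives in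
`Ω ∪ Ω_I`, so `Lu = K * u - β u` there (`nonlocalL_eq_kernelConv`).

Suppose that `u` is the primitive of an `L²` function `w` on each of `(a₁ - δ, a₁)`, `(a₁, 0)`,
`(0, a₂)` and `(a₂, a₂ + δ)`. Then `(K * u)'` is `K * w` plus, for each jump of `u`, the size of the
jump times a translate of `K`. The convolution `K * w` of two `L²` functions is continuous and
bounded, the jumps at `a₁` and `a₂` contribute `K(x - a₁)` and `K(x - a₂)`, which stay bounded for `x`
near `0`, and the jump at `0` contributes a nonzero multiple of `K(x)`, which blows up
(`eventually_hasDerivAt_kernelConv_piecewisePrimitive`). When `u` satisfies Assumption (B) and is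
`W^{1,2}` on the collar it has this form, and `u'` is bounded near `0`, so `(Lu)'` blows up.

When instead `Lu = f`, the function `(K * u - f) / β` represents `u` in `Ω` and has a jump at `0`,
because `K * u` is continuous while `f` jumps. What remains is to show that it is piecewise the
primitive of an `L²` function (`exists_L2_derivative`), and then the previous paragraph applies. Once
the primitive carrying the boundary data is moved to the right-hand side, the unknown is constant on
either side of `Ω`, and its difference quotients with step `h` satisfy the same equation with bounded
right-hand side. They are of size `1/h` only on layers of
width `h` at the three jumps, which is bounded in `L¹`, and convolution with `K ∈ L²` maps this to a
set bounded in `L²`. The nonlocal Poincaré inequality (`exists_coercivity_const`) makes `β - K *`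
coercive on functions supported in `Ω`, so the interior difference quotients are bounded in `L²`
uniformly in `h` (`exists_bound_diffQuot`), and a weak limit is the derivative.
-/

/-! ### Convolution of square-integrable functions -/

/-- The convolution `(K * U)(x) = ∫ K(x - y) U(y) dy` on the real line. -/
noncomputable def kernelConv (K U : ℝ → ℝ) (x : ℝ) : ℝ := ∫ y, K (x - y) * U y

theorem inner_toLp_eq_integral_mul {α : Type*} [MeasurableSpace α] {μ : Measure α} {f g : α → ℝ}
    (hf : MemLp f 2 μ) (hg : MemLp g 2 μ) :
    inner ℝ (hf.toLp f) (hg.toLp g) = ∫ x, f x * g x ∂μ := by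
  rw [L2.inner_def]
  refine integral_congr_ae ?_
  filter_upwards [hf.coeFn_toLp, hg.coeFn_toLp] with x h1 h2
  simp [h1, h2, mul_comm]

theorem abs_integral_mul_le_sqrt {α : Type*} [MeasurableSpace α] {μ : Measure α} {f g : α → ℝ}
    (hf : MemLp f 2 μ) (hg : MemLp g 2 μ) :
    |∫ x, f x * g x ∂μ| ≤ √(∫ x, f x ^ 2 ∂μ) * √(∫ x, g x ^ 2 ∂μ) := by
  have hn : ∀ {f : α → ℝ} (hf : MemLp f 2 μ), ‖hf.toLp f‖ = √(∫ x, f x ^ 2 ∂μ) := by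
    intro f hf
    rw [norm_eq_sqrt_real_inner, inner_toLp_eq_integral_mul hf hf]
    simp [pow_two]
  rw [← inner_toLp_eq_integral_mul hf hg, ← hn hf, ← hn hg]
  exact abs_real_inner_le_norm _ _

theorem integrable_mul_of_memLp_two {α : Type*} [MeasurableSpace α] {μ : Measure α} {f g : α → ℝ}
    (hf : MemLp f 2 μ) (hg : MemLp g 2 μ) : Integrable (fun x => f x * g x) μ :=
  hf.integrable_mul hg

theorem MeasureTheory.MemLp.comp_sub_left {f : ℝ → ℝ} {p : ENNReal} (hf : MemLp f p volume) (x : ℝ) :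
    MemLp (fun y => f (x - y)) p volume :=
  hf.comp_measurePreserving (volume.measurePreserving_sub_left x)

theorem MeasureTheory.MemLp.comp_sub_right {f : ℝ → ℝ} {p : ENNReal} (hf : MemLp f p volume) (x : ℝ) :
    MemLp (fun y => f (y - x)) p volume :=
  hf.comp_measurePreserving (measurePreserving_sub_right volume x)

theorem integrable_kernelConv_of_memLp {K w : ℝ → ℝ} (hK : MemLp K 2 volume)
    (hw : MemLp w 2 volume) (x : ℝ) : Integrable (fun y => K (x - y) * w y) :=
  integrable_mul_of_memLp_two (hK.comp_sub_left x) hw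

theorem integral_sq_comp_sub_left (f : ℝ → ℝ) (x : ℝ) :
    ∫ y, f (x - y) ^ 2 = ∫ y, f y ^ 2 :=
  integral_sub_left_eq_self (fun y => f y ^ 2) volume x

theorem abs_kernelConv_le {K w : ℝ → ℝ} (hK : MemLp K 2 volume)
    (hw : MemLp w 2 volume) (x : ℝ) :
    |kernelConv K w x| ≤ √(∫ y, K y ^ 2) * √(∫ y, w y ^ 2) := by
  have := abs_integral_mul_le_sqrt (hK.comp_sub_left x) hw
  rwa [integral_sq_comp_sub_left] at this

theorem kernelConv_eq_integral_comp_sub (K U : ℝ → ℝ) (x : ℝ) :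
    kernelConv K U x = ∫ z, K z * U (x - z) := by
  rw [kernelConv, ← integral_sub_left_eq_self (fun z => K z * U (x - z)) volume x]
  simp

/-- The convolution of two functions in `L²` is continuous: it is a uniform limit of convolutions
with continuous compactly supported functions. -/
theorem continuous_kernelConv {K w : ℝ → ℝ} (hK : MemLp K 2 volume)
    (hw : MemLp w 2 volume) : Continuous (kernelConv K w) := by
  have hK' : MemLp K (ENNReal.ofReal 2) volume := by simpa using hK
  have hex : ∀ n : ℕ, ∃ g : ℝ → ℝ, HasCompactSupport g ∧
      (∫ x, ‖K x - g x‖ ^ (2 : ℝ)) ≤ (1 / ((n : ℝ) + 1)) ^ 2 ∧ Continuous g ∧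
        MemLp g (ENNReal.ofReal 2) volume := fun n =>
    hK'.exists_hasCompactSupport_integral_rpow_sub_le (by norm_num) (by positivity)
  choose g hgs hgle hgc hgm using hex
  have hunif : TendstoUniformly (fun n => kernelConv (g n) w) (kernelConv K w) atTop := by
    rw [Metric.tendstoUniformly_iff]
    intro ε hε
    have hlim : Tendsto (fun n : ℕ => 1 / ((n : ℝ) + 1) * √(∫ y, w y ^ 2)) atTop (𝓝 0) := by
      simpa using tendsto_one_div_add_atTop_nhds_zero_nat.mul_const (√(∫ y, w y ^ 2))
    filter_upwards [hlim.eventually_lt_const hε] with n hn x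
    have hgm2 : MemLp (g n) 2 volume := by simpa using hgm n
    have hd : MemLp (fun y => K y - g n y) 2 volume := hK.sub hgm2
    have h1 : kernelConv K w x - kernelConv (g n) w x
        = kernelConv (fun y => K y - g n y) w x := by
      simp only [kernelConv]
      rw [← integral_sub (integrable_kernelConv_of_memLp hK hw x)
        (integrable_kernelConv_of_memLp hgm2 hw x)]
      congr 1; ext y; ring
    rw [Real.dist_eq, h1]
    refine ((abs_kernelConv_le hd hw x).trans ?_).trans_lt hn
    gcongr
    rw [Real.sqrt_le_left (by positivity)]
    simpa using hgle n
  refine hunif.continuous (Frequently.of_forall fun n => ?_)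
  have hloc : LocallyIntegrable w volume := hw.locallyIntegrable (by norm_num)
  have := (hgs n).continuous_convolution_right (ContinuousLinearMap.mul ℝ ℝ) hloc (hgc n)
  convert this using 1
  ext x
  simp [kernelConv, convolution_def, mul_comm]

/-! ### Differentiating a convolution with a primitive -/

/-- Integrability over a strip, which licenses exchanging `∫ ds` over a bounded interval with the
convolution integral. -/
theorem integrable_prod_strip {K w : ℝ → ℝ} (hK : Integrable K) (hw : Integrable w) (a b : ℝ) :
    Integrable (Function.uncurry fun s z => K z * w (s - z))
      ((volume.restrict (uIoc a b)).prod volume) := by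
  have h : Integrable (Function.uncurry fun s z => K z * w (s - z))
      ((volume : Measure ℝ).prod volume) :=
    hK.convolution_integrand (ContinuousLinearMap.mul ℝ ℝ) hw
  refine h.mono_measure ?_
  exact Measure.prod_mono Measure.restrict_le_self le_rfl

theorem intervalIntegral_zero_sub_eq {w : ℝ → ℝ} (hw : Integrable w) (a b : ℝ) :
    (∫ t in (0 : ℝ)..b, w t) - ∫ t in (0 : ℝ)..a, w t = ∫ t in a..b, w t :=
  intervalIntegral.integral_interval_sub_left hw.intervalIntegrable hw.intervalIntegrable

theorem abs_primitive_le {w : ℝ → ℝ} (hw : Integrable w) (a b : ℝ) :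
    |∫ t in a..b, w t| ≤ ∫ t, |w t| := by
  refine (intervalIntegral.norm_integral_le_integral_norm_uIoc (f := w) (μ := volume)).trans ?_
  exact setIntegral_le_integral hw.norm (Eventually.of_forall fun _ => norm_nonneg _)

theorem continuous_primitive_of_integrable {w : ℝ → ℝ} (hw : Integrable w) :
    Continuous fun x => ∫ t in (0 : ℝ)..x, w t :=
  intervalIntegral.continuous_primitive (fun _ _ => hw.intervalIntegrable) 0

theorem integrable_kernelConv_of_bdd {K U : ℝ → ℝ} (hK : Integrable K)
    (hU : AEStronglyMeasurable U volume) {M : ℝ} (hM : ∀ x, |U x| ≤ M) (x : ℝ) :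
    Integrable (fun y => K (x - y) * U y) :=
  Integrable.mul_bdd (c := M) (hK.comp_sub_left x) hU (Eventually.of_forall hM)

theorem integrable_kernelConv_swap_of_bdd {K U : ℝ → ℝ} (hK : Integrable K)
    (hU : AEStronglyMeasurable U volume) {M : ℝ} (hM : ∀ x, |U x| ≤ M) (x : ℝ) :
    Integrable (fun z => K z * U (x - z)) :=
  Integrable.mul_bdd (c := M) hK
    (hU.comp_measurePreserving (volume.measurePreserving_sub_left x))
    (Eventually.of_forall fun z => hM (x - z))

/-- `K * (∫₀ w) ` is a primitive of `K * w`. -/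
theorem kernelConv_primitive_sub {K w : ℝ → ℝ} (hK : Integrable K) (hw : Integrable w) (a b : ℝ) :
    kernelConv K (fun x => ∫ t in (0 : ℝ)..x, w t) b
      - kernelConv K (fun x => ∫ t in (0 : ℝ)..x, w t) a = ∫ s in a..b, kernelConv K w s := by
  have hWm := (continuous_primitive_of_integrable hw).aestronglyMeasurable (μ := volume)
  have hWb := fun x => abs_primitive_le hw 0 x
  have e : ∀ s, kernelConv K w s = ∫ z, K z * w (s - z) := kernelConv_eq_integral_comp_sub K w
  simp only [e]
  rw [intervalIntegral_integral_swap (integrable_prod_strip hK hw a b)]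
  rw [kernelConv_eq_integral_comp_sub, kernelConv_eq_integral_comp_sub,
    ← integral_sub (integrable_kernelConv_swap_of_bdd hK hWm hWb b)
      (integrable_kernelConv_swap_of_bdd hK hWm hWb a)]
  refine integral_congr_ae (Eventually.of_forall fun z => ?_)
  simp only
  rw [intervalIntegral.integral_const_mul, intervalIntegral.integral_comp_sub_right (fun t => w t),
    ← mul_sub, intervalIntegral_zero_sub_eq hw]

theorem hasDerivAt_kernelConv_primitive {K w : ℝ → ℝ} (hK : Integrable K)
    (hK2 : MemLp K 2 volume) (hw : Integrable w) (hw2 : MemLp w 2 volume) (x : ℝ) :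
    HasDerivAt (kernelConv K fun x => ∫ t in (0 : ℝ)..x, w t) (kernelConv K w x) x := by
  have hc := continuous_kernelConv hK2 hw2
  have h := (intervalIntegral.integral_hasDerivAt_right (hc.intervalIntegrable 0 x)
    (hc.stronglyMeasurableAtFilter _ _) hc.continuousAt).add_const
      (kernelConv K (fun x => ∫ t in (0 : ℝ)..x, w t) 0)
  refine h.congr_of_eventuallyEq (Eventually.of_forall fun y => ?_)
  simp only
  rw [← kernelConv_primitive_sub hK hw 0 y]
  ring

/-- The convolution of `K` with the step function `1_{(-∞, p)}` has derivative `-K(x - p)` wherever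
`K` is continuous at `x - p`. -/
theorem hasDerivAt_kernelConv_step {K : ℝ → ℝ} (hK : Integrable K) (p x : ℝ)
    (hc : ContinuousAt K (x - p)) (hm : StronglyMeasurableAtFilter K (𝓝 (x - p))) :
    HasDerivAt (kernelConv K ((Iio p).indicator fun _ => (1 : ℝ))) (-K (x - p)) x := by
  have e : ∀ y, kernelConv K ((Iio p).indicator fun _ => (1 : ℝ)) y
      = (∫ z in Ioi (x - p), K z) - ∫ z in (x - p)..(y - p), K z := by
    intro y
    rw [kernelConv_eq_integral_comp_sub, ← intervalIntegral.integral_Ioi_sub_Ioi' hK.integrableOn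
      hK.integrableOn, sub_sub_cancel, ← integral_indicator measurableSet_Ioi]
    refine integral_congr_ae (Eventually.of_forall fun z => ?_)
    simp only [indicator, mem_Iio, mem_Ioi]
    by_cases h : y - p < z
    · rw [if_pos (by linarith), if_pos h, mul_one]
    · rw [if_neg (by linarith), if_neg h, mul_zero]
  have h1 : HasDerivAt (fun y => ∫ z in (x - p)..y, K z) (K (x - p)) (x - p) :=
    intervalIntegral.integral_hasDerivAt_right hK.intervalIntegrable hm hc
  have h2 : HasDerivAt (fun y : ℝ => y - p) 1 x := (hasDerivAt_id x).sub_const p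
  have h3 := (h1.comp x h2).const_sub (∫ z in Ioi (x - p), K z)
  rw [mul_one] at h3
  refine h3.congr_of_eventuallyEq (Eventually.of_forall fun y => ?_)
  simp [e y, Function.comp]

/-! ### Coercivity of the nonlocal operator -/

theorem memLp_of_bdd_of_zero_off {w : ℝ → ℝ} {a b M : ℝ} (p : ENNReal)
    (hm : AEStronglyMeasurable w volume)
    (hM : ∀ x, |w x| ≤ M) (h0 : ∀ x, x ∉ Icc a b → w x = 0) : MemLp w p volume := by
  have hi : (Icc a b).indicator w = w :=
    indicator_eq_self.2 fun x hx => by_contra fun h => hx (h0 x h)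
  rw [← hi, memLp_indicator_iff_restrict measurableSet_Icc]
  exact MemLp.of_bound hm.restrict M (Eventually.of_forall hM)

theorem integrable_of_memLp_two_of_zero_off {w : ℝ → ℝ} {a b : ℝ}
    (hw : MemLp w 2 volume) (h0 : ∀ x, x ∉ Icc a b → w x = 0) : Integrable w volume := by
  have hi : (Icc a b).indicator w = w :=
    indicator_eq_self.2 fun x hx => by_contra fun h => hx (h0 x h)
  rw [← hi, integrable_indicator_iff measurableSet_Icc]
  exact (hw.restrict (Icc a b)).integrable (by norm_num)

theorem integral_sq_sub_translate {w : ℝ → ℝ} (hw : MemLp w 2 volume) (s t : ℝ) :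
    ∫ x, (w (x - s) - w (x - t)) ^ 2
      = 2 * (∫ x, w x ^ 2) - 2 * ∫ x, w x * w (x - (t - s)) := by
  have e1 : ∫ x, (w (x - s) - w (x - t)) ^ 2 = ∫ x, (w x - w (x - (t - s))) ^ 2 := by
    rw [← integral_sub_right_eq_self (fun x => (w x - w (x - (t - s))) ^ 2) s]
    congr 1; ext x; congr 3; ring
  have h2 := hw.comp_sub_right (t - s)
  have i1 := hw.integrable_sq
  have i2 := h2.integrable_sq
  have i3 := integrable_mul_of_memLp_two hw h2
  have e2 : ∫ x, w (x - (t - s)) ^ 2 = ∫ x, w x ^ 2 :=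
    integral_sub_right_eq_self (fun x => w x ^ 2) (t - s)
  have e3 : ∀ x, (w x - w (x - (t - s))) ^ 2
      = (w x ^ 2 + w (x - (t - s)) ^ 2) - 2 * (w x * w (x - (t - s))) := fun x => by ring
  rw [e1]
  simp only [e3]
  rw [integral_sub (f := fun x => w x ^ 2 + w (x - (t - s)) ^ 2) (i1.add i2) (i3.const_mul 2),
    integral_add i1 i2, e2, integral_const_mul]
  ring

theorem integral_mul_translate_le {w : ℝ → ℝ} (hw : MemLp w 2 volume) (z : ℝ) :
    ∫ x, w x * w (x - z) ≤ ∫ x, w x ^ 2 := by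
  have h := integral_sq_sub_translate hw 0 z
  have h0 : 0 ≤ ∫ x, (w (x - 0) - w (x - z)) ^ 2 := integral_nonneg fun x => sq_nonneg _
  rw [h, sub_zero] at h0
  linarith

/-- A function supported in an interval is decorrelated from its long translates, so, walking there
in `n` steps of length `z`, it already differs from the translate by `z`. -/
theorem integral_mul_translate_le_of_mul_ge {w : ℝ → ℝ} (hw : MemLp w 2 volume) {a b z : ℝ}
    (h0 : ∀ x, x ∉ Ioo a b → w x = 0) {n : ℕ} (hn : 0 < n) (hz : b - a ≤ n * z) :
    ∫ x, w x * w (x - z) ≤ (1 - 1 / (n : ℝ) ^ 2) * ∫ x, w x ^ 2 := by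
  have hfar : ∫ x, w x * w (x - (n * z - 0)) = 0 := by
    refine integral_eq_zero_of_ae (Eventually.of_forall fun x => ?_)
    simp only [sub_zero, Pi.zero_apply]
    by_cases hx : x ∈ Ioo a b
    · rw [h0 (x - n * z) (fun h => by linarith [hx.2, h.1]), mul_zero]
    · rw [h0 x hx, zero_mul]
  have hstep : ∀ i : ℕ, ∫ x, (w (x - i * z) - w (x - (i + 1 : ℕ) * z)) ^ 2
      = 2 * (∫ x, w x ^ 2) - 2 * ∫ x, w x * w (x - z) := by
    intro i
    rw [integral_sq_sub_translate hw]
    have : ((i + 1 : ℕ) : ℝ) * z - i * z = z := by push_cast; ring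
    rw [this]
  have hint : ∀ s t : ℝ, Integrable fun x => (w (x - s) - w (x - t)) ^ 2 := fun s t =>
    ((hw.comp_sub_right s).sub (hw.comp_sub_right t)).integrable_sq
  have hsum : ∫ x, (w (x - 0) - w (x - n * z)) ^ 2
      ≤ ∫ x, n * ∑ i ∈ Finset.range n, (w (x - i * z) - w (x - (i + 1 : ℕ) * z)) ^ 2 := by
    refine integral_mono (hint _ _)
      ((integrable_finsetSum _ fun i _ => hint _ _).const_mul _) fun x => ?_
    have h1 := Finset.sum_range_sub' (fun i : ℕ => w (x - i * z)) n
    have h2 := sq_sum_le_card_mul_sum_sq (s := Finset.range n)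
      (f := fun i : ℕ => w (x - i * z) - w (x - (i + 1 : ℕ) * z))
    rw [h1, Finset.card_range] at h2
    simpa using h2
  rw [integral_const_mul, integral_finsetSum _ fun i _ => hint _ _, integral_sq_sub_translate hw,
    hfar, Finset.sum_congr rfl fun i _ => hstep i, Finset.sum_const, Finset.card_range,
    nsmul_eq_mul] at hsum
  have hn' : (0 : ℝ) < n := by exact_mod_cast hn
  set N := ∫ x, w x ^ 2
  set A := ∫ x, w x * w (x - z)
  have h3 : N / (n : ℝ) ^ 2 ≤ N - A := by
    rw [div_le_iff₀ (by positivity)]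
    nlinarith
  have h4 : (1 - 1 / (n : ℝ) ^ 2) * N = N - N / (n : ℝ) ^ 2 := by ring
  rw [h4]; linarith

theorem exists_one_le_kernel {K : ℝ → ℝ} (hsing : SingularAtOrigin K) :
    ∃ r > 0, ∀ z ∈ Ioo 0 r, 1 ≤ K z := by
  have h := (hsing.eventually_ge_atTop 1).filter_mono (nhdsWithin_mono 0 fun z hz => ne_of_gt hz :
    𝓝[>] (0 : ℝ) ≤ 𝓝[≠] 0)
  obtain ⟨r, hr, h⟩ := mem_nhdsGT_iff_exists_Ioo_subset.1 h
  exact ⟨r, hr, fun z hz => h hz⟩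

theorem integral_kernel_pos {K : ℝ → ℝ} (hK : Integrable K) (hK0 : ∀ z, 0 ≤ K z)
    (hsing : SingularAtOrigin K) : 0 < ∫ z, K z := by
  obtain ⟨r, hr, h⟩ := exists_one_le_kernel hsing
  have h1 : ∫ z, (Ioo 0 r).indicator (fun _ => (1 : ℝ)) z ≤ ∫ z, K z := by
    refine integral_mono ((integrable_indicator_iff measurableSet_Ioo).2 (by simp)) hK fun z => ?_
    by_cases hz : z ∈ Ioo 0 r
    · simpa [hz] using h z hz
    · simpa [hz] using hK0 z
  rw [integral_indicator measurableSet_Ioo] at h1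
  simp [hr.le] at h1
  linarith

/-- The nonlocal Poincaré inequality: on functions supported in a bounded interval the form
`⟨(∫ K) w - K * w, w⟩` dominates `c ‖w‖²`. -/
theorem exists_coercivity_const {K : ℝ → ℝ} (hK : Integrable K) (hK0 : ∀ z, 0 ≤ K z)
    (hsing : SingularAtOrigin K) (a b : ℝ) :
    ∃ c > 0, ∀ (w : ℝ → ℝ) (M : ℝ), AEStronglyMeasurable w volume → (∀ x, |w x| ≤ M) →
      (∀ x, x ∉ Ioo a b → w x = 0) →
      ∫ x, w x * kernelConv K w x ≤ ((∫ z, K z) - c) * ∫ x, w x ^ 2 := by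
  obtain ⟨r, hr, hK1⟩ := exists_one_le_kernel hsing
  -- On `(r/2, r)` the kernel is at least `1`, and `n` steps of any such length exceed `b - a`.
  obtain ⟨m, hm⟩ := exists_nat_gt ((b - a) / (r / 2))
  set n := m + 1 with hn
  have hn0 : (0 : ℝ) < n := by positivity
  have hnz : b - a ≤ n * (r / 2) := by
    rw [div_lt_iff₀ (by positivity)] at hm
    have : (m : ℝ) * (r / 2) ≤ n * (r / 2) := by
      gcongr; simp [hn]
    linarith
  refine ⟨r / 2 * (1 / (n : ℝ) ^ 2), by positivity, fun w M hwm hM h0 => ?_⟩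
  have h0' : ∀ x, x ∉ Icc a b → w x = 0 := fun x hx => h0 x fun h => hx (Ioo_subset_Icc_self h)
  have hw2 : MemLp w 2 volume := memLp_of_bdd_of_zero_off 2 hwm hM h0'
  have hw1 : Integrable w := integrable_of_memLp_two_of_zero_off hw2 h0'
  have hF : Integrable (Function.uncurry fun x z => w x * (K z * w (x - z)))
      ((volume : Measure ℝ).prod volume) := by
    have h := hK.convolution_integrand (ContinuousLinearMap.mul ℝ ℝ) hw1
    exact Integrable.bdd_mul (c := M) h hwm.comp_fst
      (Eventually.of_forall fun p => hM p.1)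
  have e1 : ∫ x, w x * kernelConv K w x = ∫ z, K z * ∫ x, w x * w (x - z) := by
    simp only [kernelConv_eq_integral_comp_sub, ← integral_const_mul]
    rw [integral_integral_swap hF]
    congr 1; ext z; congr 1; ext x; ring
  have hint : Integrable fun z => K z * ∫ x, w x * w (x - z) := by
    refine hF.integral_prod_right.congr (Eventually.of_forall fun z => ?_)
    simp only [Function.uncurry, ← integral_const_mul]
    congr 1; ext x; ring
  set N := ∫ x, w x ^ 2 with hN
  have hN0 : 0 ≤ N := integral_nonneg fun x => sq_nonneg _
  have hE : Integrable ((Ioo (r / 2) r).indicator fun _ => 1 / (n : ℝ) ^ 2 * N) :=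
    (integrable_indicator_iff measurableSet_Ioo).2 (integrableOn_const (by simp))
  have hle : ∫ z, K z * ∫ x, w x * w (x - z)
      ≤ ∫ z, (K z * N - (Ioo (r / 2) r).indicator (fun _ => 1 / (n : ℝ) ^ 2 * N) z) := by
    refine integral_mono hint ((hK.mul_const N).sub hE) fun z => ?_
    by_cases hz : z ∈ Ioo (r / 2) r
    · simp only [hz, indicator_of_mem]
      have h1 := integral_mul_translate_le_of_mul_ge hw2 h0 (z := z) (n := n) (by omega)
        (hnz.trans (by gcongr; exact hz.1.le))
      have h2 := hK1 z ⟨by linarith [hz.1], hz.2⟩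
      have h3 : 0 ≤ 1 / (n : ℝ) ^ 2 * N := by positivity
      calc K z * ∫ x, w x * w (x - z) ≤ K z * ((1 - 1 / (n : ℝ) ^ 2) * N) := by
            gcongr
        _ = K z * N - K z * (1 / (n : ℝ) ^ 2 * N) := by ring
        _ ≤ K z * N - 1 / (n : ℝ) ^ 2 * N := by nlinarith
    · simp only [hz, not_false_eq_true, indicator_of_notMem, sub_zero]
      exact mul_le_mul_of_nonneg_left (integral_mul_translate_le hw2 z) (hK0 z)
  rw [e1]
  refine hle.trans (le_of_eq ?_)
  rw [integral_sub (hK.mul_const N) hE, integral_mul_const, integral_indicator measurableSet_Ioo,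
    setIntegral_const, Real.volume_real_Ioo_of_le (by linarith)]
  simp only [smul_eq_mul]
  ring

/-! ### Weak compactness in `L²` -/

/-- A bounded sequence in `L²` has a weakly convergent subsequence. -/
theorem exists_weak_limit_of_bdd {w : ℕ → ℝ → ℝ} (hw : ∀ n, MemLp (w n) 2 volume) {C : ℝ}
    (hC : ∀ n, √(∫ x, w n x ^ 2) ≤ C) :
    ∃ w₀ : ℝ → ℝ, MemLp w₀ 2 volume ∧ ∃ φ : ℕ → ℕ, StrictMono φ ∧ ∀ g : ℝ → ℝ, MemLp g 2 volume →
      Tendsto (fun n => ∫ x, w (φ n) x * g x) atTop (𝓝 (∫ x, w₀ x * g x)) := by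
  have hn : ∀ n, ‖(hw n).toLp (w n)‖ ≤ C := by
    intro n
    rw [norm_eq_sqrt_real_inner, inner_toLp_eq_integral_mul]
    simpa [pow_two] using hC n
  have : Fact ((2 : ENNReal) ≠ ⊤) := ⟨by norm_num⟩
  let E := Lp ℝ 2 (volume : Measure ℝ)
  let T : ℕ → WeakDual ℝ E := fun n =>
    StrongDual.toWeakDual (InnerProductSpace.toDual ℝ E ((hw n).toLp (w n)))
  have hseq := WeakDual.isSeqCompact_closedBall ℝ E (0 : StrongDual ℝ E) C
  obtain ⟨L, -, φ, hφ, hL⟩ := hseq (x := T) (fun n => by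
    have : ‖InnerProductSpace.toDual ℝ E ((hw n).toLp (w n))‖ ≤ C := by
      rw [LinearIsometryEquiv.norm_map]; exact hn n
    simpa [T, Metric.mem_closedBall, dist_zero_right] using this)
  let w₀ : E := (InnerProductSpace.toDual ℝ E).symm (WeakDual.toStrongDual L)
  refine ⟨w₀, Lp.memLp w₀, φ, hφ, fun g hg => ?_⟩
  have h1 : Tendsto (fun n => T (φ n) (hg.toLp g)) atTop (𝓝 (L (hg.toLp g))) :=
    ((WeakDual.eval_continuous (hg.toLp g)).tendsto L).comp hL
  have h2 : L (hg.toLp g) = inner ℝ w₀ (hg.toLp g) := by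
    simp only [w₀, InnerProductSpace.toDual_symm_apply]; rfl
  have h3 : inner ℝ w₀ (hg.toLp g) = ∫ x, w₀ x * g x := by
    rw [← inner_toLp_eq_integral_mul (Lp.memLp w₀) hg, Lp.toLp_coeFn]
  rw [← h3, ← h2]
  refine h1.congr fun n => ?_
  rw [← inner_toLp_eq_integral_mul (hw (φ n)) hg]
  rfl

/-! ### Regularity of bounded solutions of the convolution equation -/

/-- The forward difference quotient of `V` with step `h`. -/
noncomputable def diffQuot (V : ℝ → ℝ) (h x : ℝ) : ℝ := (V (x + h) - V x) / h

/-- The points from which a step of length `h` stays inside `(a, 0)` or inside `(0, b)`. -/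
def stepDomain (a b h : ℝ) : Set ℝ := Ioo a (-h) ∪ Ioo 0 (b - h)

theorem measurableSet_stepDomain (a b h : ℝ) : MeasurableSet (stepDomain a b h) :=
  measurableSet_Ioo.union measurableSet_Ioo

theorem abs_diffQuot_le {V : ℝ → ℝ} {M : ℝ} (hM : ∀ x, |V x| ≤ M) {h : ℝ} (hh : 0 < h) (x : ℝ) :
    |diffQuot V h x| ≤ 2 * M / h := by
  rw [diffQuot, abs_div, abs_of_pos hh]
  gcongr
  exact (abs_sub _ _).trans (by linarith [hM x, hM (x + h)])

theorem aestronglyMeasurable_diffQuot {V : ℝ → ℝ} (hV : AEStronglyMeasurable V volume) (h : ℝ) :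
    AEStronglyMeasurable (diffQuot V h) volume := by
  have h1 := hV.comp_measurePreserving (measurePreserving_add_right volume h)
  exact ((h1.sub hV).mul_const h⁻¹).congr
    (Eventually.of_forall fun x => by simp [diffQuot, div_eq_mul_inv])

/-- The difference quotient commutes with convolution. -/
theorem kernelConv_diffQuot {K V : ℝ → ℝ} (hK : Integrable K)
    (hV : AEStronglyMeasurable V volume) {M : ℝ} (hM : ∀ x, |V x| ≤ M) (h x : ℝ) :
    kernelConv K (diffQuot V h) x = diffQuot (kernelConv K V) h x := by
  rw [diffQuot, kernelConv_eq_integral_comp_sub, kernelConv_eq_integral_comp_sub,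
    kernelConv_eq_integral_comp_sub, ← integral_sub (integrable_kernelConv_swap_of_bdd hK hV hM _)
      (integrable_kernelConv_swap_of_bdd hK hV hM _), ← integral_div]
  congr 1; ext z
  rw [diffQuot, show x - z + h = x + h - z by ring]
  ring

theorem kernelConv_add_of_bdd {K U V : ℝ → ℝ} (hK : Integrable K)
    (hU : AEStronglyMeasurable U volume) {M : ℝ} (hM : ∀ x, |U x| ≤ M)
    (hV : AEStronglyMeasurable V volume) {M' : ℝ} (hM' : ∀ x, |V x| ≤ M') (x : ℝ) :
    kernelConv K (fun y => U y + V y) x = kernelConv K U x + kernelConv K V x := by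
  rw [kernelConv, kernelConv, kernelConv, ← integral_add (integrable_kernelConv_of_bdd hK hU hM x)
    (integrable_kernelConv_of_bdd hK hV hM' x)]
  congr 1; ext y; ring

/-- Pairing a convolution `K * r` with `w`: an `L¹`–`L²` bound by Fubini and Cauchy–Schwarz. -/
theorem integral_mul_kernelConv_le {K r w : ℝ → ℝ} (hK : Integrable K) (hK2 : MemLp K 2 volume)
    (hr : Integrable r) (hw2 : MemLp w 2 volume) {M : ℝ} (hM : ∀ x, |w x| ≤ M) :
    ∫ x, w x * kernelConv K r x
      ≤ (∫ y, |r y|) * (√(∫ y, K y ^ 2) * √(∫ x, w x ^ 2)) := by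
  have hF : Integrable (Function.uncurry fun x y => w x * (K (x - y) * r y))
      ((volume : Measure ℝ).prod volume) := by
    have h := hr.convolution_integrand (ContinuousLinearMap.mul ℝ ℝ).flip hK
    exact Integrable.bdd_mul (c := M) h hw2.1.comp_fst (Eventually.of_forall fun p => hM p.1)
  have e : ∫ x, w x * kernelConv K r x = ∫ y, r y * ∫ x, K (x - y) * w x := by
    simp only [kernelConv, ← integral_const_mul]
    rw [integral_integral_swap hF]
    congr 1; ext y; congr 1; ext x; ring
  rw [e, ← integral_mul_const]
  refine (le_abs_self _).trans ((abs_integral_le_integral_abs).trans ?_)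
  refine integral_mono_of_nonneg (Eventually.of_forall fun y => abs_nonneg _)
    (hr.abs.mul_const _) (Eventually.of_forall fun y => ?_)
  simp only [abs_mul]
  gcongr
  have := abs_integral_mul_le_sqrt (hK2.comp_sub_right y) hw2
  rwa [integral_sub_right_eq_self (fun x => K x ^ 2) y] at this

theorem integral_abs_le_sqrt_mul {w : ℝ → ℝ} {a b : ℝ} (hab : a ≤ b) (hw : MemLp w 2 volume)
    (h0 : ∀ x, x ∉ Icc a b → w x = 0) :
    ∫ x, |w x| ≤ √(b - a) * √(∫ x, w x ^ 2) := by
  have h1 : MemLp ((Icc a b).indicator fun _ => (1 : ℝ)) 2 volume :=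
    memLp_indicator_const 2 measurableSet_Icc 1 (Or.inr (by simp))
  have h2 := abs_integral_mul_le_sqrt h1 hw.abs
  have e1 : ∀ x, (Icc a b).indicator (fun _ => (1 : ℝ)) x * |w x| = |w x| := fun x => by
    by_cases hx : x ∈ Icc a b
    · simp [hx]
    · simp [hx, h0 x hx]
  have e2 : ∀ x, (Icc a b).indicator (fun _ => (1 : ℝ)) x ^ 2
      = (Icc a b).indicator (fun _ => (1 : ℝ)) x := fun x => by
    by_cases hx : x ∈ Icc a b <;> simp [hx]
  simp only [Pi.abs_apply, e1, e2, sq_abs] at h2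
  rw [integral_indicator measurableSet_Icc, setIntegral_const, Real.volume_real_Icc_of_le hab]
    at h2
  simpa using (le_abs_self _).trans h2

/-- The jumps of `V` at `a`, `0`, `b` make its difference quotients unbounded only on three layers
of width `h`, where they are `O(1/h)`. -/
theorem integral_abs_diffQuot_layers_le {V : ℝ → ℝ} {a b M cl cr h : ℝ}
    (hM : ∀ x, |V x| ≤ M) (hl : ∀ x ≤ a, V x = cl) (hr : ∀ x, b ≤ x → V x = cr) (hh : 0 < h)
    (hV : AEStronglyMeasurable V volume) :
    let r := fun x => diffQuot V h x - (stepDomain a b h).indicator (diffQuot V h) x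
    Integrable r ∧ (∫ x, |r x|) ≤ 6 * M := by
  intro r
  have hM0 : 0 ≤ M := (abs_nonneg _).trans (hM 0)
  have hD := aestronglyMeasurable_diffQuot hV h
  have hrm : AEStronglyMeasurable r volume :=
    hD.sub (hD.indicator (measurableSet_stepDomain a b h))
  let B : ℝ → ℝ := fun x => (Icc (a - h) a).indicator (fun _ => 2 * M / h) x
    + (Icc (-h) 0).indicator (fun _ => 2 * M / h) x
    + (Icc (b - h) b).indicator (fun _ => 2 * M / h) x
  have hi : ∀ s t : ℝ, Integrable ((Icc s t).indicator fun _ => 2 * M / h) := fun s t =>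
    (integrable_indicator_iff measurableSet_Icc).2 (integrableOn_const (by simp))
  have hB : Integrable B := ((hi _ _).add (hi _ _)).add (hi _ _)
  have hMh : 0 ≤ 2 * M / h := by positivity
  have hpos : ∀ (s : Set ℝ) x, 0 ≤ s.indicator (fun _ => 2 * M / h) x := fun s x =>
    indicator_nonneg (fun _ _ => hMh) x
  have hle : ∀ x, |r x| ≤ B x := by
    intro x
    have hb := abs_diffQuot_le hM hh x
    have p1 := hpos (Icc (a - h) a) x
    have p2 := hpos (Icc (-h) 0) x
    have p3 := hpos (Icc (b - h) b) x
    by_cases hx : x ∈ stepDomain a b h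
    · simp only [r, hx, indicator_of_mem, sub_self, abs_zero, B]
      linarith
    · simp only [r, hx, not_false_eq_true, indicator_of_notMem, sub_zero, B]
      by_cases h1 : x < a - h
      · rw [diffQuot, hl x (by linarith), hl (x + h) (by linarith)]
        simp only [sub_self, zero_div, abs_zero]
        linarith
      by_cases h2 : x ≤ a
      · have : x ∈ Icc (a - h) a := ⟨not_lt.1 h1, h2⟩
        rw [indicator_of_mem this]; linarith
      by_cases h3 : b < x
      · rw [diffQuot, hr x h3.le, hr (x + h) (by linarith)]
        simp only [sub_self, zero_div, abs_zero]
        linarith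
      by_cases h4 : b - h ≤ x
      · have : x ∈ Icc (b - h) b := ⟨h4, not_lt.1 h3⟩
        rw [indicator_of_mem this]; linarith
      by_cases h5 : x ∈ Icc (-h) 0
      · rw [indicator_of_mem h5]; linarith
      · exfalso
        refine hx ?_
        by_cases h6 : x < -h
        · exact Or.inl ⟨not_le.1 h2, h6⟩
        · exact Or.inr ⟨not_le.1 fun h7 => h5 ⟨not_lt.1 h6, h7⟩, not_le.1 h4⟩
  refine ⟨hB.mono' hrm (Eventually.of_forall hle), ?_⟩
  have e : ∀ s : ℝ, ∫ x, (Icc (s - h) s).indicator (fun _ => 2 * M / h) x = 2 * M := fun s => by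
    rw [integral_indicator measurableSet_Icc, setIntegral_const,
      Real.volume_real_Icc_of_le (by linarith), smul_eq_mul]
    field_simp
    ring
  have e0 := e 0
  rw [zero_sub] at e0
  calc ∫ x, |r x| ≤ ∫ x, B x := integral_mono_of_nonneg
        (Eventually.of_forall fun x => abs_nonneg _) hB (Eventually.of_forall hle)
    _ = 6 * M := by
        simp only [B]
        rw [integral_add (f := fun x => (Icc (a - h) a).indicator (fun _ => 2 * M / h) x
          + (Icc (-h) 0).indicator (fun _ => 2 * M / h) x) ((hi _ _).add (hi _ _)) (hi _ _),
          integral_add (hi _ _) (hi _ _),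
          e a, e b, e0]
        ring

/-- The `L²` bound on interior difference quotients, uniform in the step: test the differenced
equation with the difference quotient itself and use coercivity. -/
theorem exists_bound_diffQuot {K V H : ℝ → ℝ} {a b M L cl cr : ℝ}
    (hK : Integrable K) (hK0 : ∀ z, 0 ≤ K z) (hsing : SingularAtOrigin K) (hK2 : MemLp K 2 volume)
    (ha : a < 0) (hb : 0 < b)
    (hV : AEStronglyMeasurable V volume) (hM : ∀ x, |V x| ≤ M)
    (hl : ∀ x ≤ a, V x = cl) (hr : ∀ x, b ≤ x → V x = cr)
    (heq : ∀ x ∈ Ioo a 0 ∪ Ioo 0 b, (∫ z, K z) * V x = kernelConv K V x + H x)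
    (hL0 : 0 ≤ L) (hHa : ∀ x ∈ Ioo a 0, ∀ y ∈ Ioo a 0, |H y - H x| ≤ L * |y - x|)
    (hHb : ∀ x ∈ Ioo 0 b, ∀ y ∈ Ioo 0 b, |H y - H x| ≤ L * |y - x|) :
    ∃ C, ∀ h, 0 < h → √(∫ x, (stepDomain a b h).indicator (diffQuot V h) x ^ 2) ≤ C := by
  obtain ⟨c, hc, hcoer⟩ := exists_coercivity_const hK hK0 hsing a b
  refine ⟨(6 * M * √(∫ y, K y ^ 2) + L * √(b - a)) / c, fun h hh => ?_⟩
  have hM0 : 0 ≤ M := (abs_nonneg _).trans (hM 0)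
  have hS := measurableSet_stepDomain a b h
  have hSsub : ∀ x ∈ stepDomain a b h, x ∈ Ioo a b := by
    rintro x (hx | hx)
    · exact ⟨hx.1, by linarith [hx.2]⟩
    · exact ⟨by linarith [hx.1], by linarith [hx.2]⟩
  have hD := aestronglyMeasurable_diffQuot hV h
  set w := (stepDomain a b h).indicator (diffQuot V h) with hw
  have hwm : AEStronglyMeasurable w volume := hD.indicator hS
  have hMh : 0 ≤ 2 * M / h := by positivity
  have hwM : ∀ x, |w x| ≤ 2 * M / h := by
    intro x
    by_cases hx : x ∈ stepDomain a b h
    · simp only [hw, hx, indicator_of_mem]; exact abs_diffQuot_le hM hh x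
    · simpa only [hw, hx, not_false_eq_true, indicator_of_notMem, abs_zero] using hMh
  have hw0 : ∀ x, x ∉ Ioo a b → w x = 0 := fun x hx =>
    indicator_of_notMem (fun h => hx (hSsub x h)) _
  have hw0' : ∀ x, x ∉ Icc a b → w x = 0 := fun x hx =>
    hw0 x fun h => hx (Ioo_subset_Icc_self h)
  have hw2 : MemLp w 2 volume := memLp_of_bdd_of_zero_off 2 hwm hwM hw0'
  have hw1 : Integrable w := integrable_of_memLp_two_of_zero_off hw2 hw0'
  obtain ⟨hr1, hr6⟩ := integral_abs_diffQuot_layers_le hM hl hr hh hV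
  set r : ℝ → ℝ := fun x => diffQuot V h x - w x with hrdef
  have hrm : AEStronglyMeasurable r volume := hD.sub hwm
  have hrM : ∀ x, |r x| ≤ 2 * M / h + 2 * M / h := fun x =>
    (abs_sub _ _).trans (add_le_add (abs_diffQuot_le hM hh x) (hwM x))
  have hconv : ∀ x, kernelConv K (diffQuot V h) x = kernelConv K w x + kernelConv K r x := by
    intro x
    rw [← kernelConv_add_of_bdd hK hwm hwM hrm hrM]
    congr 1; ext y; simp [hrdef]
  set β := ∫ z, K z with hβ
  set N := ∫ x, w x ^ 2 with hN
  have hN0 : 0 ≤ N := integral_nonneg fun x => sq_nonneg _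
  -- The differenced equation times `w`; the Lipschitz bound on `H` controls the last term.
  have hpt : ∀ x, β * w x ^ 2 ≤ w x * kernelConv K w x + w x * kernelConv K r x + L * |w x| := by
    intro x
    by_cases hx : x ∈ stepDomain a b h
    · have hwx : w x = diffQuot V h x := indicator_of_mem hx _
      have hpair : x ∈ Ioo a 0 ∪ Ioo 0 b ∧ x + h ∈ Ioo a 0 ∪ Ioo 0 b
          ∧ |H (x + h) - H x| ≤ L * h := by
        rcases hx with hx | hx
        · have h1 : x ∈ Ioo a 0 := ⟨hx.1, by linarith [hx.2]⟩
          have h2 : x + h ∈ Ioo a 0 := ⟨by linarith [hx.1], by linarith [hx.2]⟩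
          have h3 := hHa x h1 (x + h) h2
          rw [add_sub_cancel_left, abs_of_pos hh] at h3
          exact ⟨Or.inl h1, Or.inl h2, h3⟩
        · have h1 : x ∈ Ioo 0 b := ⟨hx.1, by linarith [hx.2]⟩
          have h2 : x + h ∈ Ioo 0 b := ⟨by linarith [hx.1], by linarith [hx.2]⟩
          have h3 := hHb x h1 (x + h) h2
          rw [add_sub_cancel_left, abs_of_pos hh] at h3
          exact ⟨Or.inr h1, Or.inr h2, h3⟩
      obtain ⟨h1, h2, h3⟩ := hpair
      have e1 := heq x h1
      have e2 := heq (x + h) h2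
      have e3 : β * w x = kernelConv K w x + kernelConv K r x + (H (x + h) - H x) / h := by
        rw [← hconv, kernelConv_diffQuot hK hV hM, hwx, diffQuot, diffQuot]
        field_simp
        linarith
      have e4 : |(H (x + h) - H x) / h| ≤ L := by
        rw [abs_div, abs_of_pos hh, div_le_iff₀ hh]; exact h3
      have e5 : w x * ((H (x + h) - H x) / h) ≤ L * |w x| := by
        refine (le_abs_self _).trans ?_
        rw [abs_mul, mul_comm]
        gcongr
      calc β * w x ^ 2 = w x * (β * w x) := by ring
        _ ≤ _ := by rw [e3]; linarith
    · have hwx : w x = 0 := indicator_of_notMem hx _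
      simp [hwx]
  have hKw := continuous_kernelConv hK2 hw2
  have hr2 : MemLp r 2 volume := by
    refine memLp_of_bdd_of_zero_off (a := a - h) (b := b) 2 hrm hrM fun x hx => ?_
    have hx' : x ∉ Icc a b := fun h' => hx ⟨by linarith [h'.1], h'.2⟩
    simp only [hrdef, hw0' x hx', sub_zero, diffQuot]
    by_cases h1 : x < a - h
    · rw [hl x (by linarith), hl (x + h) (by linarith)]; simp
    · have h2 : b < x := by
        by_contra h2
        exact hx ⟨not_lt.1 h1, not_lt.1 h2⟩
      rw [hr x h2.le, hr (x + h) (by linarith)]; simp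
  have hKr := continuous_kernelConv hK2 hr2
  have i1 : Integrable fun x => w x * kernelConv K w x :=
    Integrable.mul_bdd hw1 hKw.aestronglyMeasurable
      (Eventually.of_forall fun x => abs_kernelConv_le hK2 hw2 x)
  have i2 : Integrable fun x => w x * kernelConv K r x :=
    Integrable.mul_bdd hw1 hKr.aestronglyMeasurable
      (Eventually.of_forall fun x => abs_kernelConv_le hK2 hr2 x)
  have i3 : Integrable fun x => L * |w x| := hw1.abs.const_mul L
  have hint := integral_mono (hw2.integrable_sq.const_mul β) ((i1.add i2).add i3) hpt
  simp only [Pi.add_apply] at hint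
  rw [integral_const_mul, integral_add (f := fun x => w x * kernelConv K w x
    + w x * kernelConv K r x) (i1.add i2) i3, integral_add i1 i2, integral_const_mul] at hint
  have b1 := hcoer w _ hwm hwM hw0
  have b2 := integral_mul_kernelConv_le hK hK2 hr1 hw2 hwM
  have b3 := integral_abs_le_sqrt_mul (by linarith) hw2 hw0'
  have b2' : (∫ y, |r y|) * (√(∫ y, K y ^ 2) * √N) ≤ 6 * M * (√(∫ y, K y ^ 2) * √N) := by
    gcongr
  have b3' : L * ∫ x, |w x| ≤ L * (√(b - a) * √N) := by gcongr
  have hfin : c * N ≤ (6 * M * √(∫ y, K y ^ 2) + L * √(b - a)) * √N := by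
    nlinarith
  rw [le_div_iff₀ hc]
  rcases (Real.sqrt_nonneg N).eq_or_lt with h0 | h0
  · rw [← h0]; simp only [zero_mul]; positivity
  · have hsq := Real.mul_self_sqrt hN0
    have : (√N * c) * √N ≤ (6 * M * √(∫ y, K y ^ 2) + L * √(b - a)) * √N := by
      calc (√N * c) * √N = c * (√N * √N) := by ring
        _ ≤ _ := by rw [hsq]; exact hfin
    exact le_of_mul_le_mul_right this h0

theorem tendsto_intervalIntegral_diffQuot {V : ℝ → ℝ} {M x y : ℝ}
    (hV : AEStronglyMeasurable V volume) (hM : ∀ x, |V x| ≤ M)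
    (hx : ContinuousAt V x) (hy : ContinuousAt V y) {ι : Type*} {l : Filter ι} {h : ι → ℝ}
    (hh : Tendsto h l (𝓝[≠] 0)) :
    Tendsto (fun n => ∫ t in x..y, diffQuot V (h n) t) l (𝓝 (V y - V x)) := by
  have hi : ∀ s t : ℝ, IntervalIntegrable V volume s t := fun s t => by
    rw [intervalIntegrable_iff]
    exact Measure.integrableOn_of_bounded (M := M) (by simp) hV (Eventually.of_forall hM)
  have hd : ∀ p, ContinuousAt V p →
      Tendsto (fun n => (h n)⁻¹ * ∫ t in p..(p + h n), V t) l (𝓝 (V p)) := by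
    intro p hp
    have h1 : HasDerivAt (fun u => ∫ t in p..u, V t) (V p) p :=
      intervalIntegral.integral_hasDerivAt_right (hi p p) hV.stronglyMeasurableAtFilter hp
    have h2 := (hasDerivAt_iff_tendsto_slope_zero.1 h1).comp hh
    simpa [Function.comp_def] using h2
  refine ((hd y hy).sub (hd x hx)).congr fun n => ?_
  simp only [diffQuot]
  rw [intervalIntegral.integral_div, intervalIntegral.integral_sub _ (hi _ _),
    intervalIntegral.integral_comp_add_right (fun t => V t)]
  · have e1 := intervalIntegral.integral_add_adjacent_intervals (hi x y) (hi y (y + h n))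
    have e2 := intervalIntegral.integral_add_adjacent_intervals (hi x (x + h n))
      (hi (x + h n) (y + h n))
    rw [div_eq_inv_mul, ← mul_sub]
    congr 1
    linarith
  · have := (hi (x + h n) (y + h n)).comp_add_right (h n)
    simpa using this

/-- A bounded piecewise continuous solution of `(∫ K) V = K * V + H`, constant outside `(a, b)`,
with `H` Lipschitz on `(a, 0)` and on `(0, b)`, has a square-integrable derivative there. -/
theorem exists_L2_derivative {K V H : ℝ → ℝ} {a b M L cl cr : ℝ}
    (hK : Integrable K) (hK0 : ∀ z, 0 ≤ K z) (hsing : SingularAtOrigin K) (hK2 : MemLp K 2 volume)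
    (ha : a < 0) (hb : 0 < b)
    (hV : AEStronglyMeasurable V volume) (hM : ∀ x, |V x| ≤ M)
    (hl : ∀ x ≤ a, V x = cl) (hr : ∀ x, b ≤ x → V x = cr)
    (heq : ∀ x ∈ Ioo a 0 ∪ Ioo 0 b, (∫ z, K z) * V x = kernelConv K V x + H x)
    (hL0 : 0 ≤ L) (hHa : ∀ x ∈ Ioo a 0, ∀ y ∈ Ioo a 0, |H y - H x| ≤ L * |y - x|)
    (hHb : ∀ x ∈ Ioo 0 b, ∀ y ∈ Ioo 0 b, |H y - H x| ≤ L * |y - x|)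
    (hVc : ∀ x ∈ Ioo a 0 ∪ Ioo 0 b, ContinuousAt V x) :
    ∃ w : ℝ → ℝ, MemLp w 2 volume ∧
      (∀ x y, x ≤ y → (x ∈ Ioo a 0 ∧ y ∈ Ioo a 0 ∨ x ∈ Ioo 0 b ∧ y ∈ Ioo 0 b) →
        V y - V x = ∫ t in x..y, w t) := by
  obtain ⟨C, hC⟩ := exists_bound_diffQuot hK hK0 hsing hK2 ha hb hV hM hl hr heq hL0 hHa hHb
  let h : ℕ → ℝ := fun n => 1 / ((n : ℝ) + 1)
  have hpos : ∀ n, 0 < h n := fun n => by positivity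
  have hlim : Tendsto h atTop (𝓝 0) := tendsto_one_div_add_atTop_nhds_zero_nat
  -- Weak limits of the interior difference quotients are tested against indicators of segments.
  have hlim' : Tendsto h atTop (𝓝[≠] 0) := tendsto_nhdsWithin_iff.2
    ⟨hlim, Eventually.of_forall fun n => (hpos n).ne'⟩
  let w : ℕ → ℝ → ℝ := fun n => (stepDomain a b (h n)).indicator (diffQuot V (h n))
  have hw : ∀ n, MemLp (w n) 2 volume := fun n => by
    refine memLp_of_bdd_of_zero_off (a := a) (b := b) (M := 2 * M / h n) 2
      ((aestronglyMeasurable_diffQuot hV _).indicator (measurableSet_stepDomain _ _ _))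
      (fun x => ?_) (fun x hx => indicator_of_notMem (fun hx' => hx ?_) _)
    · refine (norm_indicator_le_norm_self (diffQuot V (h n)) x).trans ?_
      exact abs_diffQuot_le hM (hpos n) x
    · have := hpos n
      rcases hx' with hx' | hx'
      · exact ⟨hx'.1.le, by linarith [hx'.2]⟩
      · exact ⟨by linarith [hx'.1], by linarith [hx'.2]⟩
  obtain ⟨w₀, hw₀, φ, hφ, hconv⟩ := exists_weak_limit_of_bdd hw fun n => hC (h n) (hpos n)
  refine ⟨w₀, hw₀, fun x y hxy hp => ?_⟩
  have hg : MemLp ((Ioc x y).indicator fun _ => (1 : ℝ)) 2 volume :=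
    memLp_indicator_const 2 measurableSet_Ioc 1 (Or.inr (by simp))
  have e : ∀ f : ℝ → ℝ, ∫ t, f t * (Ioc x y).indicator (fun _ => (1 : ℝ)) t
      = ∫ t in x..y, f t := by
    intro f
    rw [intervalIntegral.integral_of_le hxy, ← integral_indicator measurableSet_Ioc]
    congr 1; ext t
    by_cases ht : t ∈ Ioc x y <;> simp [ht]
  have h1 := hconv _ hg
  simp only [e] at h1
  have hx : x ∈ Ioo a 0 ∪ Ioo 0 b := hp.imp (fun h => h.1) (fun h => h.1)
  have hy : y ∈ Ioo a 0 ∪ Ioo 0 b := hp.imp (fun h => h.2) (fun h => h.2)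
  have h2 := tendsto_intervalIntegral_diffQuot hV hM (hVc x hx) (hVc y hy)
    (hlim'.comp hφ.tendsto_atTop)
  refine tendsto_nhds_unique h2 (h1.congr' ?_)
  -- For small steps the whole segment `[x, y]` lies in the step domain.
  have hsmall : ∀ᶠ n in atTop, ∀ t ∈ Icc x y, t ∈ stepDomain a b (h (φ n)) := by
    have hl' := hlim.comp hφ.tendsto_atTop
    rcases hp with ⟨hx, hy⟩ | ⟨hx, hy⟩
    · filter_upwards [hl'.eventually_lt_const (show (0 : ℝ) < -y by linarith [hy.2])] with n hn t ht
      simp only [Function.comp] at hn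
      exact Or.inl ⟨hx.1.trans_le ht.1, by linarith [ht.2]⟩
    · filter_upwards [hl'.eventually_lt_const (show (0 : ℝ) < b - y by linarith [hy.2])]
        with n hn t ht
      simp only [Function.comp] at hn
      exact Or.inr ⟨hx.1.trans_le ht.1, by linarith [ht.2]⟩
  filter_upwards [hsmall] with n hn
  refine intervalIntegral.integral_congr fun t ht => ?_
  rw [uIcc_of_le hxy] at ht
  exact indicator_of_mem (hn t ht) _

/-! ### One-dimensional Sobolev functions are primitives -/

theorem exists_Icc_of_isCompact_subset_Ioo {S : Set ℝ} {p q : ℝ} (hS : IsCompact S)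
    (hsub : S ⊆ Ioo p q) (hpq : p < q) : ∃ s t, p < s ∧ t < q ∧ S ⊆ Icc s t := by
  rcases S.eq_empty_or_nonempty with rfl | hne
  · exact ⟨q, p, hpq, hpq, empty_subset _⟩
  · exact ⟨sInf S, sSup S, (hsub (hS.sInf_mem hne)).1, (hsub (hS.sSup_mem hne)).2, fun x hx =>
      ⟨csInf_le hS.bddBelow hx, le_csSup hS.bddAbove hx⟩⟩

theorem eq_zero_of_tsupport_subset {φ : ℝ → ℝ} {S : Set ℝ} (h : tsupport φ ⊆ S) {x : ℝ}
    (hx : x ∉ S) : φ x = 0 :=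
  image_eq_zero_of_notMem_tsupport fun h' => hx (h h')

/-- A test function on `(p, q)` with zero integral is the derivative of a test function. -/
theorem exists_test_primitive {η : ℝ → ℝ} {p q : ℝ} (hpq : p < q) (hη : ContDiff ℝ ∞ η)
    (hc : HasCompactSupport η) (hs : tsupport η ⊆ Ioo p q) (h0 : ∫ x, η x = 0) :
    ∃ φ : ℝ → ℝ, ContDiff ℝ ∞ φ ∧ HasCompactSupport φ ∧ tsupport φ ⊆ Ioo p q ∧ deriv φ = η := by
  obtain ⟨s, t, hps, htq, hst⟩ := exists_Icc_of_isCompact_subset_Ioo hc hs hpq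
  have hηc := hη.continuous
  have hd : ∀ x, HasDerivAt (fun x => ∫ y in p..x, η y) (η x) x := fun x =>
    intervalIntegral.integral_hasDerivAt_right (hηc.intervalIntegrable _ _)
      (hηc.stronglyMeasurableAtFilter _ _) hηc.continuousAt
  have hderiv : deriv (fun x => ∫ y in p..x, η y) = η := funext fun x => (hd x).deriv
  have hz : ∀ x, x ∉ Icc s t → η x = 0 := fun x hx => eq_zero_of_tsupport_subset hst hx
  have hzero : ∀ x, x ∉ Icc s t → ∫ y in p..x, η y = 0 := by
    intro x hx
    rcases lt_or_ge x s with h | h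
    · refine intervalIntegral.integral_zero_ae (Eventually.of_forall fun y hy => hz y fun h' => ?_)
      have := hy.2
      rcases le_max_iff.1 this with h2 | h2 <;> linarith [h'.1]
    · have hxt : t < x := by
        by_contra h2; exact hx ⟨h, not_lt.1 h2⟩
      rcases lt_or_ge t s with hts | hts
      · refine intervalIntegral.integral_zero_ae
          (Eventually.of_forall fun y _ => hz y fun h' => ?_)
        linarith [h'.1, h'.2]
      rw [intervalIntegral.integral_of_le (by linarith), ← h0]
      refine setIntegral_eq_integral_of_forall_compl_eq_zero fun y hy => hz y fun h' => hy ?_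
      exact ⟨by linarith [h'.1], by linarith [h'.2]⟩
  have hts : tsupport (fun x => ∫ y in p..x, η y) ⊆ Icc s t :=
    closure_minimal (fun x hx => by_contra fun h => hx (hzero x h)) isClosed_Icc
  refine ⟨fun x => ∫ y in p..x, η y, ?_, ?_, ?_, hderiv⟩
  · rw [contDiff_infty_iff_deriv, hderiv]
    exact ⟨fun x => (hd x).differentiableAt, hη⟩
  · exact isCompact_Icc.of_isClosed_subset (isClosed_tsupport _) hts
  · exact fun x hx => ⟨hps.trans_le (hts hx).1, (hts hx).2.trans_lt htq⟩

/-- The du Bois-Reymond lemma: a function with zero weak derivative on an interval is constant. -/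
theorem ae_eq_const_of_integral_mul_deriv_eq_zero {F : ℝ → ℝ} {p q : ℝ} (hpq : p < q)
    (hF : IntegrableOn F (Ioo p q))
    (h : ∀ φ : ℝ → ℝ, ContDiff ℝ ∞ φ → HasCompactSupport φ → tsupport φ ⊆ Ioo p q →
      ∫ x in Ioo p q, F x * deriv φ x = 0) :
    ∃ k, ∀ᵐ x, x ∈ Ioo p q → F x = k := by
  let ψ : ContDiffBump ((p + q) / 2) := ⟨(q - p) / 8, (q - p) / 4, by linarith, by linarith⟩
  set ψ₀ := ψ.normed volume with hψ₀
  have hψs : tsupport ψ₀ ⊆ Ioo p q := by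
    rw [hψ₀, ψ.tsupport_normed_eq, Real.closedBall_eq_Icc]
    intro x hx
    have : ψ.rOut = (q - p) / 4 := rfl
    rw [this] at hx
    exact ⟨by linarith [hx.1], by linarith [hx.2]⟩
  have hψ1 : ∫ x, ψ₀ x = 1 := ψ.integral_normed
  have hψd : ContDiff ℝ ∞ ψ₀ := ψ.contDiff_normed
  have hψc : HasCompactSupport ψ₀ := ψ.hasCompactSupport_normed
  have hmul : ∀ θ : ℝ → ℝ, Continuous θ → HasCompactSupport θ →
      IntegrableOn (fun x => F x * θ x) (Ioo p q) := by
    intro θ hθ hθc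
    obtain ⟨C, hC⟩ := hθ.bounded_above_of_compact_support hθc
    exact Integrable.mul_bdd (c := C) hF hθ.aestronglyMeasurable (Eventually.of_forall hC)
  set k := ∫ x in Ioo p q, F x * ψ₀ x with hk
  have hFk : IntegrableOn (fun x => F x - k) (Ioo p q) :=
    Integrable.sub hF (integrableOn_const (by simp))
  refine ⟨k, ?_⟩
  have := isOpen_Ioo.ae_eq_zero_of_integral_contDiff_smul_eq_zero (μ := volume)
    (f := fun x => F x - k) hFk.locallyIntegrableOn fun θ hθ hθc hθs => ?_
  · filter_upwards [this] with x hx hxI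
    linarith [hx hxI]
  set m := ∫ x, θ x with hm
  have hθi : Integrable θ := hθ.continuous.integrable_of_hasCompactSupport hθc
  have hψi : Integrable ψ₀ := hψd.continuous.integrable_of_hasCompactSupport hψc
  have hη : ContDiff ℝ ∞ fun x => θ x - m * ψ₀ x := hθ.sub (contDiff_const.mul hψd)
  have hηs : tsupport (fun x => θ x - m * ψ₀ x) ⊆ tsupport θ ∪ tsupport ψ₀ := by
    refine closure_minimal (fun x hx => ?_) ((isClosed_tsupport _).union (isClosed_tsupport _))
    by_contra hx'
    rw [mem_union, not_or] at hx'
    apply hx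
    simp [image_eq_zero_of_notMem_tsupport hx'.1, image_eq_zero_of_notMem_tsupport hx'.2]
  have hηc : HasCompactSupport fun x => θ x - m * ψ₀ x :=
    (IsCompact.union hθc hψc).of_isClosed_subset (isClosed_tsupport _) hηs
  obtain ⟨φ, h1, h2, h3, h4⟩ := exists_test_primitive hpq hη hηc
    (hηs.trans (union_subset hθs hψs)) (by
      rw [integral_sub hθi (hψi.const_mul m), integral_const_mul, hψ1]; simp [hm])
  have h5 := h φ h1 h2 h3
  rw [h4] at h5
  have e1 : ∫ x in Ioo p q, F x * (θ x - m * ψ₀ x)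
      = (∫ x in Ioo p q, F x * θ x) - m * k := by
    rw [hk, ← integral_const_mul, ← integral_sub (hmul θ hθ.continuous hθc)
      ((hmul ψ₀ hψd.continuous hψc).const_mul m)]
    congr 1; ext x; ring
  have e2 : ∫ x in Ioo p q, θ x = m :=
    setIntegral_eq_integral_of_forall_compl_eq_zero fun x hx => eq_zero_of_tsupport_subset hθs hx
  have e3 : ∫ x, θ x • (F x - k) = ∫ x in Ioo p q, (F x * θ x - k * θ x) := by
    rw [← setIntegral_eq_integral_of_forall_compl_eq_zero (s := Ioo p q)
      fun x hx => by rw [eq_zero_of_tsupport_subset hθs hx, zero_smul]]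
    congr 1; ext x; simp only [smul_eq_mul]; ring
  rw [e3, integral_sub (hmul θ hθ.continuous hθc) (hθi.restrict.const_mul k), integral_const_mul,
    e2]
  linarith

/-- A function with an integrable weak derivative on an interval is a.e. a primitive of it. The base
point `0` need not lie in the interval. -/
theorem ae_eq_primitive_of_weakDeriv {f g : ℝ → ℝ} {p q : ℝ} (hpq : p < q)
    (hf : IntegrableOn f (Ioo p q)) (hg : Integrable g)
    (h : ∀ φ : ℝ → ℝ, ContDiff ℝ ∞ φ → HasCompactSupport φ → tsupport φ ⊆ Ioo p q →
      ∫ x in Ioo p q, f x * deriv φ x = - ∫ x in Ioo p q, g x * φ x) :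
    ∃ c, ∀ᵐ x, x ∈ Ioo p q → f x = (∫ t in (0 : ℝ)..x, g t) + c := by
  have hGc : Continuous fun x => ∫ t in p..x, g t :=
    intervalIntegral.continuous_primitive (fun _ _ => hg.intervalIntegrable) p
  have hGi : IntegrableOn (fun x => ∫ t in p..x, g t) (Ioo p q) :=
    (hGc.integrableOn_Icc (a := p) (b := q)).mono_set Ioo_subset_Icc_self
  obtain ⟨k, hk⟩ := ae_eq_const_of_integral_mul_deriv_eq_zero hpq (hf.sub hGi)
    fun φ hφ hφc hφs => by
      have hφ' : Continuous (deriv φ) := hφ.continuous_deriv (by simp)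
      have hφ's : HasCompactSupport (deriv φ) := hφc.deriv
      obtain ⟨C, hC⟩ := hφ'.bounded_above_of_compact_support hφ's
      have hb : ∀ u : ℝ → ℝ, IntegrableOn u (Ioo p q) →
          IntegrableOn (fun x => u x * deriv φ x) (Ioo p q) := fun u hu =>
        Integrable.mul_bdd (c := C) hu hφ'.aestronglyMeasurable (Eventually.of_forall hC)
      have hGac : AbsolutelyContinuousOnInterval (fun x => ∫ t in p..x, g t) p q :=
        hg.intervalIntegrable.absolutelyContinuousOnInterval_intervalIntegral (by simp)
      have hφac : AbsolutelyContinuousOnInterval φ p q :=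
        ((hφ.of_le (by simp)).contDiffOn).absolutelyContinuousOnInterval
      have hibp := hGac.integral_mul_deriv_eq_deriv_mul hφac
      have z : φ q = 0 := eq_zero_of_tsupport_subset hφs (by simp)
      have hgd : ∫ x in p..q, deriv (fun x => ∫ t in p..x, g t) x * φ x
          = ∫ x in p..q, g x * φ x := by
        refine intervalIntegral.integral_congr_ae ?_
        filter_upwards [(hg.intervalIntegrable (a := p) (b := q)).ae_hasDerivAt_integral]
          with x hx hxI
        rw [(hx (uIoc_subset_uIcc hxI) p (by simp)).deriv]
      rw [hgd, z, intervalIntegral.integral_same, mul_zero, zero_mul, sub_zero, zero_sub,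
        intervalIntegral.integral_of_le hpq.le, intervalIntegral.integral_of_le hpq.le,
        integral_Ioc_eq_integral_Ioo, integral_Ioc_eq_integral_Ioo] at hibp
      have e : ∀ x, (f - fun x => ∫ t in p..x, g t) x * deriv φ x
          = f x * deriv φ x - (∫ t in p..x, g t) * deriv φ x := fun x => by
        simp only [Pi.sub_apply]; ring
      simp only [e]
      rw [integral_sub (hb f hf) (hb _ hGi), hibp, h φ hφ hφc hφs, sub_self]
  refine ⟨k - ∫ t in (0 : ℝ)..p, g t, ?_⟩
  filter_upwards [hk] with x hx hxI
  have h1 := hx hxI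
  simp only [Pi.sub_apply] at h1
  have h2 := intervalIntegral_zero_sub_eq hg p x
  linarith

/-! ### The kernel away from the origin -/

theorem continuousAt_kernel {δ : ℝ} {K : ℝ → ℝ} (hA1 : KernelA1 δ K) (hA2 : KernelA2 δ K) {y : ℝ}
    (h0 : y ≠ 0) (h1 : y ≠ δ) (h2 : y ≠ -δ) : ContinuousAt K y := by
  rcases lt_or_ge δ |y| with h | h
  · have : K =ᶠ[𝓝 y] fun _ => 0 := by
      filter_upwards [continuous_abs.continuousAt.eventually_const_lt h] with z hz
      exact hA1.zero_of_le z hz.le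
    exact continuousAt_const.congr this.symm
  · have h' := abs_le.1 h
    rcases lt_or_gt_of_ne h0 with hy | hy
    · exact hA2.smooth_neg.continuousOn.continuousAt
        (Ioo_mem_nhds (lt_of_le_of_ne h'.1 h2.symm) hy)
    · exact hA2.smooth_pos.continuousOn.continuousAt (Ioo_mem_nhds hy (lt_of_le_of_ne h'.2 h1))

theorem eventually_punctured_ne (q c : ℝ) : ∀ᶠ y in 𝓝[≠] q, y ≠ c := by
  rcases eq_or_ne q c with rfl | h
  · exact self_mem_nhdsWithin
  · exact (eventually_ne_nhds h).filter_mono nhdsWithin_le_nhds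

theorem eventually_continuousAt_kernel {δ : ℝ} {K : ℝ → ℝ} (hA1 : KernelA1 δ K)
    (hA2 : KernelA2 δ K) (q : ℝ) : ∀ᶠ y in 𝓝[≠] q, ContinuousAt K y := by
  filter_upwards [eventually_punctured_ne q 0, eventually_punctured_ne q δ,
    eventually_punctured_ne q (-δ)] with y h0 h1 h2
  exact continuousAt_kernel hA1 hA2 h0 h1 h2

theorem exists_tendsto_kernel {δ : ℝ} {K : ℝ → ℝ} (hA1 : KernelA1 δ K)
    (hA2 : KernelA2 δ K) {q : ℝ} (hq : q ≠ 0) :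
    (∃ l, Tendsto K (𝓝[<] q) (𝓝 l)) ∧ ∃ l, Tendsto K (𝓝[>] q) (𝓝 l) := by
  by_cases h1 : q = δ
  · subst h1
    refine ⟨hA2.limit_pos, 0, tendsto_const_nhds.congr' ?_⟩
    filter_upwards [self_mem_nhdsWithin] with y hy
    exact (hA1.zero_of_le y ((le_of_lt hy).trans (le_abs_self y))).symm
  by_cases h2 : q = -δ
  · subst h2
    refine ⟨⟨0, tendsto_const_nhds.congr' ?_⟩, hA2.limit_neg⟩
    filter_upwards [self_mem_nhdsWithin] with y hy
    refine (hA1.zero_of_le y (le_trans ?_ (neg_le_abs y))).symm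
    have : y < -δ := hy
    linarith
  have := continuousAt_kernel hA1 hA2 hq h1 h2
  exact ⟨⟨_, this.mono_left nhdsWithin_le_nhds⟩, _, this.mono_left nhdsWithin_le_nhds⟩

theorem exists_bound_kernel {δ : ℝ} {K : ℝ → ℝ} (hA1 : KernelA1 δ K)
    (hA2 : KernelA2 δ K) {q : ℝ} (hq : q ≠ 0) : ∃ C, ∀ᶠ y in 𝓝[≠] q, |K y| ≤ C := by
  obtain ⟨⟨l, hl⟩, r, hr⟩ := exists_tendsto_kernel hA1 hA2 hq
  refine ⟨max (|l| + 1) (|r| + 1), ?_⟩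
  rw [← Iio_union_Ioi, nhdsWithin_union, eventually_sup]
  constructor
  · filter_upwards [hl.abs.eventually_lt_const (lt_add_one |l|)] with y hy
    exact hy.le.trans (le_max_left _ _)
  · filter_upwards [hr.abs.eventually_lt_const (lt_add_one |r|)] with y hy
    exact hy.le.trans (le_max_right _ _)

theorem tendsto_sub_punctured (p : ℝ) : Tendsto (fun x => x - p) (𝓝[≠] 0) (𝓝[≠] (-p)) := by
  refine tendsto_nhdsWithin_iff.2 ⟨?_, ?_⟩
  · have : Tendsto (fun x : ℝ => x - p) (𝓝 0) (𝓝 (0 - p)) :=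
      (continuous_id.sub continuous_const).tendsto 0
    rw [zero_sub] at this
    exact this.mono_left nhdsWithin_le_nhds
  · filter_upwards [self_mem_nhdsWithin] with x hx h
    exact hx (by simp only [mem_singleton_iff] at h ⊢; linarith)

/-! ### Convolution with a piecewise primitive -/

/-- The function equal to the primitive `∫₀ˣ w` plus the constants `c₁`, `c₂`, `c₃`, `c₄` on
`(-∞, p)`, `[p, 0)`, `[0, q)`, `[q, ∞)` respectively (for `p < 0 < q`). -/
noncomputable def piecewisePrimitive (w : ℝ → ℝ) (p q c₁ c₂ c₃ c₄ x : ℝ) : ℝ :=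
  (∫ t in (0 : ℝ)..x, w t) + c₄ + (c₁ - c₂) * (Iio p).indicator (fun _ => 1) x
    + (c₂ - c₃) * (Iio 0).indicator (fun _ => 1) x + (c₃ - c₄) * (Iio q).indicator (fun _ => 1) x

theorem kernelConv_piecewisePrimitive {K w : ℝ → ℝ} (hK : Integrable K) (hw : Integrable w)
    (p q c₁ c₂ c₃ c₄ x : ℝ) :
    kernelConv K (piecewisePrimitive w p q c₁ c₂ c₃ c₄) x
      = kernelConv K (fun x => ∫ t in (0 : ℝ)..x, w t) x + c₄ * (∫ z, K z)
        + (c₁ - c₂) * kernelConv K ((Iio p).indicator fun _ => 1) x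
        + (c₂ - c₃) * kernelConv K ((Iio 0).indicator fun _ => 1) x
        + (c₃ - c₄) * kernelConv K ((Iio q).indicator fun _ => 1) x := by
  have i0 := integrable_kernelConv_of_bdd hK
    (continuous_primitive_of_integrable hw).aestronglyMeasurable (abs_primitive_le hw 0) x
  have i1 : Integrable fun y => c₄ * K (x - y) := (hK.comp_sub_left x).const_mul c₄
  have i2 : ∀ c s : ℝ, Integrable fun y => c * (K (x - y) * (Iio s).indicator (fun _ => 1) y) :=
    fun c s => (integrable_kernelConv_of_bdd (M := 1) hK
      ((measurable_const.indicator measurableSet_Iio).aestronglyMeasurable) (fun y => by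
        by_cases hy : y ∈ Iio s <;> simp [hy]) x).const_mul c
  have e : c₄ * (∫ z, K z) = ∫ y, c₄ * K (x - y) := by
    rw [integral_const_mul, integral_sub_left_eq_self]
  simp only [kernelConv] at i0 ⊢
  rw [e, ← integral_const_mul, ← integral_const_mul, ← integral_const_mul, ← integral_add' i0 i1,
    ← integral_add' (i0.add i1) (i2 _ _), ← integral_add' ((i0.add i1).add (i2 _ _)) (i2 _ _),
    ← integral_add' (((i0.add i1).add (i2 _ _)).add (i2 _ _)) (i2 _ _)]
  refine integral_congr_ae (Eventually.of_forall fun y => ?_)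
  simp only [piecewisePrimitive, Pi.add_apply]
  ring

/-- Near `0`, the derivative of `K * U` for a piecewise primitive `U` is, up to a bounded term, the
kernel times the jump of `U` at `0`: the derivative of `U` is `L²`, and its jumps at `p`, `q ≠ 0`
only see the kernel away from its singularity. -/
theorem eventually_hasDerivAt_kernelConv_piecewisePrimitive {δ : ℝ} {K w : ℝ → ℝ}
    (hA1 : KernelA1 δ K) (hA2 : KernelA2 δ K) (hK2 : MemLp K 2 volume) (hw : Integrable w)
    (hw2 : MemLp w 2 volume) {p q : ℝ} (hp : p ≠ 0) (hq : q ≠ 0) (c₁ c₂ c₃ c₄ : ℝ) :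
    ∃ (e : ℝ → ℝ) (C : ℝ), ∀ᶠ x in 𝓝[≠] 0, |e x| ≤ C ∧
      HasDerivAt (kernelConv K (piecewisePrimitive w p q c₁ c₂ c₃ c₄))
        ((c₃ - c₂) * K x + e x) x := by
  have hK := hA1.integrable
  obtain ⟨Cp, hCp⟩ := exists_bound_kernel hA1 hA2 (neg_ne_zero.2 hp)
  obtain ⟨Cq, hCq⟩ := exists_bound_kernel hA1 hA2 (neg_ne_zero.2 hq)
  refine ⟨fun x => kernelConv K w x + (c₁ - c₂) * -K (x - p) + (c₃ - c₄) * -K (x - q),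
    √(∫ y, K y ^ 2) * √(∫ y, w y ^ 2) + |c₁ - c₂| * Cp + |c₃ - c₄| * Cq, ?_⟩
  have hcont := fun s => (tendsto_sub_punctured s).eventually
    (eventually_continuousAt_kernel hA1 hA2 (-s))
  filter_upwards [hcont p, hcont 0, hcont q, (tendsto_sub_punctured p).eventually hCp,
    (tendsto_sub_punctured q).eventually hCq] with x hxp hx0 hxq hbp hbq
  refine ⟨?_, ?_⟩
  · refine (abs_add_le _ _).trans (add_le_add ((abs_add_le _ _).trans (add_le_add
      (abs_kernelConv_le hK2 hw2 x) ?_)) ?_)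
    · rw [abs_mul, abs_neg]; gcongr
    · rw [abs_mul, abs_neg]; gcongr
  · have hm : ∀ s, StronglyMeasurableAtFilter K (𝓝 (x - s)) := fun s =>
      hK.aestronglyMeasurable.stronglyMeasurableAtFilter
    have d0 := hasDerivAt_kernelConv_primitive hK hK2 hw hw2 x
    have d1 := hasDerivAt_kernelConv_step hK p x hxp (hm p)
    have d2 := hasDerivAt_kernelConv_step hK 0 x hx0 (hm 0)
    have d3 := hasDerivAt_kernelConv_step hK q x hxq (hm q)
    have d := (((d0.add_const (c₄ * ∫ z, K z)).add (d1.const_mul (c₁ - c₂))).add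
      (d2.const_mul (c₂ - c₃))).add (d3.const_mul (c₃ - c₄))
    rw [sub_zero] at d
    refine (d.congr_of_eventuallyEq (Eventually.of_forall fun y =>
      kernelConv_piecewisePrimitive hK hw p q c₁ c₂ c₃ c₄ y)).congr_deriv ?_
    ring

/-- A nonzero multiple of the singular kernel dominates any bounded term. -/
theorem derivBlowsUpAtZero_of_hasDerivAt {K v e : ℝ → ℝ} {s C : ℝ} (hs : s ≠ 0)
    (hsing : SingularAtOrigin K)
    (h : ∀ᶠ x in 𝓝[≠] 0, |e x| ≤ C ∧ HasDerivAt v (s * K x + e x) x) :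
    DerivBlowsUpAtZero v := by
  have hlim : Tendsto (fun x => |deriv v x|) (𝓝[≠] 0) atTop := by
    have h1 : Tendsto (fun x => |s| * K x - C) (𝓝[≠] 0) atTop :=
      tendsto_atTop_add_const_right _ _ (hsing.const_mul_atTop (abs_pos.2 hs))
    refine tendsto_atTop_mono' _ ?_ h1
    filter_upwards [h] with x hx
    rw [hx.2.deriv]
    have h2 := abs_sub_abs_le_abs_sub (s * K x) (-e x)
    rw [abs_neg, sub_neg_eq_add, abs_mul] at h2
    have h3 : |s| * K x ≤ |s| * |K x| := by gcongr; exact le_abs_self _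
    linarith [hx.1]
  exact ⟨h.mono fun x hx => hx.2.differentiableAt,
    hlim.mono_left (nhdsWithin_mono _ fun x hx => ne_of_lt hx),
    hlim.mono_left (nhdsWithin_mono _ fun x hx => ne_of_gt hx)⟩

/-! ### The nonlocal operator as a convolution -/

theorem domain_union_collar_eq {a₁ a₂ δ : ℝ} (h : a₁ < a₂) (hδ : 0 < δ) :
    domainΩ a₁ a₂ ∪ collarΩ a₁ a₂ δ = Ioo (a₁ - δ) (a₂ + δ) := by
  ext x
  simp only [domainΩ, collarΩ, mem_union, mem_Ioo, mem_Ioc, mem_Ico]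
  constructor
  · rintro (⟨h1, h2⟩ | ⟨h1, h2⟩ | ⟨h1, h2⟩) <;> constructor <;> linarith
  · rintro ⟨h1, h2⟩
    rcases le_or_gt x a₁ with h3 | h3
    · exact Or.inr (Or.inl ⟨h1, h3⟩)
    · rcases lt_or_ge x a₂ with h4 | h4
      · exact Or.inl ⟨h3, h4⟩
      · exact Or.inr (Or.inr ⟨h4, h2⟩)

/-- The collar has width `δ`, so from a point of `Ω` the kernel only sees `Ω ∪ Ω_I`. -/
theorem kernel_eq_zero_of_notMem {a₁ a₂ δ : ℝ} {K : ℝ → ℝ} (hA1 : KernelA1 δ K) {x y : ℝ}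
    (hx : x ∈ Ioo a₁ a₂) (hy : y ∉ Ioo (a₁ - δ) (a₂ + δ)) : K (x - y) = 0 := by
  refine hA1.zero_of_le _ ?_
  by_contra h
  have h' := abs_lt.1 (not_le.1 h)
  exact hy ⟨by linarith [hx.1, h'.2], by linarith [hx.2, h'.1]⟩

theorem nonlocalL_eq_kernelConv {a₁ a₂ δ : ℝ} {K u : ℝ → ℝ} (h : a₁ < a₂) (hδ : 0 < δ)
    (hA1 : KernelA1 δ K) (hK2 : MemLp K 2 volume)
    (hu : MemLp ((Ioo (a₁ - δ) (a₂ + δ)).indicator u) 2 volume) {x : ℝ} (hx : x ∈ Ioo a₁ a₂) :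
    nonlocalL a₁ a₂ δ K u x
      = kernelConv K ((Ioo (a₁ - δ) (a₂ + δ)).indicator u) x - (∫ z, K z) * u x := by
  have hrad : ∀ z, K |z| = K z := fun z => by
    rcases abs_choice z with h | h <;> rw [h]
    exact hA1.radial z
  have e : ∫ y, u x * K (x - y) = (∫ z, K z) * u x := by
    rw [integral_const_mul, integral_sub_left_eq_self, mul_comm]
  rw [nonlocalL, domain_union_collar_eq h hδ, ← integral_indicator measurableSet_Ioo, kernelConv,
    ← e, ← integral_sub (integrable_kernelConv_of_memLp hK2 hu x)
      ((hA1.integrable.comp_sub_left x).const_mul (u x))]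
  refine integral_congr_ae (Eventually.of_forall fun y => ?_)
  by_cases hy : y ∈ Ioo (a₁ - δ) (a₂ + δ)
  · simp only [hy, indicator_of_mem, hrad]; ring
  · simp only [hy, not_false_eq_true, indicator_of_notMem, kernel_eq_zero_of_notMem hA1 hx hy]
    ring

theorem kernelConv_indicator_congr {a₁ a₂ δ : ℝ} {K u U : ℝ → ℝ}
    (hA1 : KernelA1 δ K) (hu : ∀ᵐ y, y ∈ Ioo (a₁ - δ) (a₂ + δ) → u y = U y)
    {x : ℝ} (hx : x ∈ Ioo a₁ a₂) :
    kernelConv K ((Ioo (a₁ - δ) (a₂ + δ)).indicator u) x = kernelConv K U x := by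
  refine integral_congr_ae ?_
  filter_upwards [hu] with y h
  by_cases hy : y ∈ Ioo (a₁ - δ) (a₂ + δ)
  · simp only [hy, indicator_of_mem, h hy]
  · simp only [hy, not_false_eq_true, indicator_of_notMem, kernel_eq_zero_of_notMem hA1 hx hy,
      zero_mul]

/-! ### Gluing the pieces -/

theorem primitive_eq_of_zero {d : ℝ → ℝ} (hd : Integrable d) {s t : ℝ}
    (h : ∀ x ∈ uIoc s t, d x = 0) : ∫ x in (0 : ℝ)..t, d x = ∫ x in (0 : ℝ)..s, d x := by
  have h1 := intervalIntegral_zero_sub_eq hd s t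
  rw [intervalIntegral.integral_zero_ae (Eventually.of_forall h)] at h1
  linarith

theorem piecewisePrimitive_eq (w : ℝ → ℝ) {p q : ℝ} (hp : p < 0) (hq : 0 < q) (c₁ c₂ c₃ c₄ x : ℝ) :
    piecewisePrimitive w p q c₁ c₂ c₃ c₄ x = (∫ t in (0 : ℝ)..x, w t)
      + if x < p then c₁ else if x < 0 then c₂ else if x < q then c₃ else c₄ := by
  simp only [piecewisePrimitive, indicator, mem_Iio]
  split_ifs <;> linarith

theorem memLp_indicator_piecewisePrimitive {w : ℝ → ℝ} (hw : Integrable w)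
    (p q c₁ c₂ c₃ c₄ s t : ℝ) :
    MemLp ((Ioo s t).indicator (piecewisePrimitive w p q c₁ c₂ c₃ c₄)) 2 volume := by
  rw [memLp_indicator_iff_restrict measurableSet_Ioo]
  have h0 : MemLp (fun x => ∫ t in (0 : ℝ)..x, w t) 2 (volume.restrict (Ioo s t)) :=
    MemLp.of_bound (continuous_primitive_of_integrable hw).aestronglyMeasurable _
      (Eventually.of_forall (abs_primitive_le hw 0))
  have h1 : ∀ a : ℝ, MemLp ((Iio a).indicator fun _ => (1 : ℝ)) 2 (volume.restrict (Ioo s t)) :=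
    fun a => (memLp_const 1).indicator measurableSet_Iio
  exact (((h0.add (memLp_const c₄)).add ((h1 p).const_mul _)).add ((h1 0).const_mul _)).add
    ((h1 q).const_mul _)

/-- A function that is a primitive of an `L²` function on each of `(a₁ - δ, a₁)`, `(a₁, 0)`,
`(0, a₂)`, `(a₂, a₂ + δ)` is almost everywhere a piecewise primitive. -/
theorem exists_piecewisePrimitive {a₁ a₂ δ k₁ k₄ : ℝ} (ha₁ : a₁ < 0) (ha₂ : 0 < a₂)
    {g d V u : ℝ → ℝ} (hg : Integrable g) (hg2 : MemLp g 2 volume)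
    (hg0 : ∀ x ∈ Ioo a₁ a₂, g x = 0) (hd2 : MemLp d 2 volume)
    (hV : ∀ x y, x ≤ y → (x ∈ Ioo a₁ 0 ∧ y ∈ Ioo a₁ 0 ∨ x ∈ Ioo 0 a₂ ∧ y ∈ Ioo 0 a₂) →
        V y - V x = ∫ t in x..y, d t)
    (hl : ∀ᵐ y, y ∈ Ioo (a₁ - δ) a₁ → u y = (∫ t in (0 : ℝ)..y, g t) + k₁)
    (hr : ∀ᵐ y, y ∈ Ioo a₂ (a₂ + δ) → u y = (∫ t in (0 : ℝ)..y, g t) + k₄)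
    (hu : ∀ᵐ y, y ∈ Ioo a₁ a₂ → u y = V y) :
    ∃ (w : ℝ → ℝ) (c₁ c₂ c₃ c₄ : ℝ), Integrable w ∧ MemLp w 2 volume ∧
      (∀ᵐ y, y ∈ Ioo (a₁ - δ) (a₂ + δ) → u y = piecewisePrimitive w a₁ a₂ c₁ c₂ c₃ c₄ y) ∧
      (∀ y ∈ Ioo a₁ 0, V y = (∫ t in (0 : ℝ)..y, w t) + c₂) ∧
      (∀ y ∈ Ioo 0 a₂, V y = (∫ t in (0 : ℝ)..y, w t) + c₃) := by
  set d' := (Ioo a₁ a₂).indicator d with hd'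
  have hd'2 : MemLp d' 2 volume := hd2.indicator measurableSet_Ioo
  have hd'0 : ∀ x, x ∉ Ioo a₁ a₂ → d' x = 0 := fun x hx => indicator_of_notMem hx _
  have hd'i : Integrable d' := integrable_of_memLp_two_of_zero_off (a := a₁) (b := a₂) hd'2
    fun x hx => hd'0 x fun h => hx (Ioo_subset_Icc_self h)
  set w := fun x => g x + d' x with hwdef
  have hw : Integrable w := hg.add hd'i
  have hW : ∀ x, ∫ t in (0 : ℝ)..x, w t = (∫ t in (0 : ℝ)..x, g t) + ∫ t in (0 : ℝ)..x, d' t :=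
    fun x => intervalIntegral.integral_add hg.intervalIntegrable hd'i.intervalIntegrable
  have hwd : ∀ x y, x ≤ y → x ∈ Ioo a₁ a₂ → y ∈ Ioo a₁ a₂ →
      (∫ t in (0 : ℝ)..y, w t) - (∫ t in (0 : ℝ)..x, w t) = ∫ t in x..y, d t := by
    intro x y hxy hx hy
    rw [intervalIntegral_zero_sub_eq hw]
    refine intervalIntegral.integral_congr fun t ht => ?_
    rw [uIcc_of_le hxy] at ht
    have ht' : t ∈ Ioo a₁ a₂ := ⟨hx.1.trans_le ht.1, ht.2.trans_lt hy.2⟩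
    simp only [hwdef, hg0 t ht', zero_add, hd', indicator_of_mem ht']
  have hconst : ∀ x y, (x ∈ Ioo a₁ 0 ∧ y ∈ Ioo a₁ 0 ∨ x ∈ Ioo 0 a₂ ∧ y ∈ Ioo 0 a₂) →
      V y = (∫ t in (0 : ℝ)..y, w t) + (V x - ∫ t in (0 : ℝ)..x, w t) := by
    intro x y h
    have hx : x ∈ Ioo a₁ a₂ := by
      rcases h with h | h
      · exact ⟨h.1.1, h.1.2.trans ha₂⟩
      · exact ⟨ha₁.trans h.1.1, h.1.2⟩
    have hy : y ∈ Ioo a₁ a₂ := by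
      rcases h with h | h
      · exact ⟨h.2.1, h.2.2.trans ha₂⟩
      · exact ⟨ha₁.trans h.2.1, h.2.2⟩
    rcases le_total x y with hxy | hxy
    · linarith [hV x y hxy h, hwd x y hxy hx hy]
    · linarith [hV y x hxy (h.imp And.symm And.symm), hwd y x hxy hy hx]
  have hm₁ : a₁ / 2 ∈ Ioo a₁ 0 := ⟨by linarith, by linarith⟩
  have hm₂ : a₂ / 2 ∈ Ioo 0 a₂ := ⟨by linarith, by linarith⟩
  set c₂ := V (a₁ / 2) - ∫ t in (0 : ℝ)..(a₁ / 2), w t with hc₂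
  set c₃ := V (a₂ / 2) - ∫ t in (0 : ℝ)..(a₂ / 2), w t with hc₃
  have hV₂ : ∀ y ∈ Ioo a₁ 0, V y = (∫ t in (0 : ℝ)..y, w t) + c₂ := fun y hy =>
    hconst _ y (Or.inl ⟨hm₁, hy⟩)
  have hV₃ : ∀ y ∈ Ioo 0 a₂, V y = (∫ t in (0 : ℝ)..y, w t) + c₃ := fun y hy =>
    hconst _ y (Or.inr ⟨hm₂, hy⟩)
  refine ⟨w, k₁ - ∫ t in (0 : ℝ)..a₁, d' t, c₂, c₃, k₄ - ∫ t in (0 : ℝ)..a₂, d' t, hw,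
    hg2.add hd'2, ?_, hV₂, hV₃⟩
  have hne : ∀ c : ℝ, ∀ᵐ y, y ≠ c := fun c => Measure.ae_ne volume c
  filter_upwards [hl, hr, hu, hne a₁, hne 0, hne a₂] with y h1 h2 h3 n1 n2 n3 hy
  rw [piecewisePrimitive_eq w ha₁ ha₂]
  rcases lt_or_gt_of_ne n1 with hy1 | hy1
  · have e := primitive_eq_of_zero hd'i (s := a₁) (t := y) fun x hx => hd'0 x fun hx' => by
      rw [uIoc_of_ge hy1.le] at hx
      linarith [hx.2, hx'.1]
    rw [if_pos hy1, h1 ⟨hy.1, hy1⟩, hW, e]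
    ring
  rw [if_neg (not_lt.2 hy1.le)]
  rcases lt_or_gt_of_ne n2 with hy2 | hy2
  · rw [if_pos hy2, h3 ⟨hy1, hy2.trans ha₂⟩, hV₂ y ⟨hy1, hy2⟩]
  rw [if_neg (not_lt.2 hy2.le)]
  rcases lt_or_gt_of_ne n3 with hy3 | hy3
  · rw [if_pos hy3, h3 ⟨hy1, hy3⟩, hV₃ y ⟨hy2, hy3⟩]
  · have e := primitive_eq_of_zero hd'i (s := a₂) (t := y) fun x hx => hd'0 x fun hx' => by
      rw [uIoc_of_le hy3.le] at hx
      linarith [hx.1, hx'.2]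
    rw [if_neg (not_lt.2 hy3.le), h2 ⟨hy3, hy.2⟩, hW, e]
    ring

/-- The constants on both sides of `0` are the one-sided limits, as the primitive vanishes there. -/
theorem constants_eq_limits {V w : ℝ → ℝ} {a₁ a₂ c₂ c₃ l r : ℝ} (ha₁ : a₁ < 0) (ha₂ : 0 < a₂)
    (hw : Integrable w) (h₂ : ∀ y ∈ Ioo a₁ 0, V y = (∫ t in (0 : ℝ)..y, w t) + c₂)
    (h₃ : ∀ y ∈ Ioo 0 a₂, V y = (∫ t in (0 : ℝ)..y, w t) + c₃)
    (hl : Tendsto V (𝓝[<] 0) (𝓝 l)) (hr : Tendsto V (𝓝[>] 0) (𝓝 r)) : c₂ = l ∧ c₃ = r := by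
  have hW : ∀ c : ℝ, Tendsto (fun y => (∫ t in (0 : ℝ)..y, w t) + c) (𝓝 0) (𝓝 c) := fun c => by
    have := ((continuous_primitive_of_integrable hw).add_const c).tendsto 0
    simpa using this
  constructor
  · refine tendsto_nhds_unique ((hW c₂).mono_left nhdsWithin_le_nhds) (hl.congr' ?_)
    filter_upwards [Ioo_mem_nhdsLT ha₁] with y hy using h₂ y hy
  · refine tendsto_nhds_unique ((hW c₃).mono_left nhdsWithin_le_nhds) (hr.congr' ?_)
    filter_upwards [Ioo_mem_nhdsGT ha₂] with y hy using h₃ y hy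

/-- The values of `b ∈ W^{1,2}(Ω_I)` on the two components of the collar come from a single primitive,
normalised at `0 ∈ Ω`; as `g = 0` on `[a₁, a₂]`, this primitive vanishes in `Ω`. -/
theorem exists_primitive_of_memW12Collar {a₁ a₂ δ : ℝ} {b : ℝ → ℝ} (h : a₁ < a₂) (hδ : 0 < δ)
    (hb : MemW12Collar a₁ a₂ δ b) :
    ∃ (g : ℝ → ℝ) (k₁ k₄ : ℝ), Integrable g ∧ MemLp g 2 volume ∧ (∀ x ∈ Icc a₁ a₂, g x = 0) ∧
      (∀ᵐ y, y ∈ Ioo (a₁ - δ) a₁ → b y = (∫ t in (0 : ℝ)..y, g t) + k₁) ∧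
      (∀ᵐ y, y ∈ Ioo a₂ (a₂ + δ) → b y = (∫ t in (0 : ℝ)..y, g t) + k₄) := by
  obtain ⟨hb2, g₀, hg₀, hweak⟩ := hb
  set S := Ioo (a₁ - δ) a₁ ∪ Ioo a₂ (a₂ + δ) with hS
  have hSm : MeasurableSet S := measurableSet_Ioo.union measurableSet_Ioo
  have hg2 : MemLp (S.indicator g₀) 2 volume := (memLp_indicator_iff_restrict hSm).2 hg₀
  have hg : Integrable (S.indicator g₀) := by
    refine integrable_of_memLp_two_of_zero_off (a := a₁ - δ) (b := a₂ + δ) hg2 fun x hx =>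
      indicator_of_notMem (fun hx' => hx ?_) _
    rcases hx' with hx' | hx'
    · exact ⟨hx'.1.le, by linarith [hx'.2]⟩
    · exact ⟨by linarith [hx'.1], hx'.2.le⟩
  have hSfin : IsFiniteMeasure (volume.restrict S) :=
    ⟨by
      rw [Measure.restrict_apply_univ]
      exact (measure_union_le _ _).trans_lt (by simp)⟩
  have hbi : IntegrableOn b S := hb2.integrable (by norm_num)
  have main : ∀ p q, p < q → Ioo p q ⊆ S →
      ∃ c, ∀ᵐ x, x ∈ Ioo p q → b x = (∫ t in (0 : ℝ)..x, S.indicator g₀ t) + c := by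
    intro p q hpq hsub
    refine ae_eq_primitive_of_weakDeriv hpq (hbi.mono_set hsub) hg fun φ hφ hφc hφs => ?_
    have hw := hweak φ hφ hφc (hφs.trans hsub)
    have hd : ∀ x, x ∉ Ioo p q → deriv φ x = 0 := fun x hx =>
      eq_zero_of_tsupport_subset (tsupport_deriv_subset.trans hφs) hx
    have hz : ∀ x, x ∉ Ioo p q → φ x = 0 := fun x hx => eq_zero_of_tsupport_subset hφs hx
    rw [setIntegral_eq_of_subset_of_forall_sdiff_eq_zero hSm hsub fun x hx => by
        rw [hd x hx.2, mul_zero],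
      setIntegral_eq_of_subset_of_forall_sdiff_eq_zero hSm hsub fun x hx => by
        rw [hz x hx.2, mul_zero]] at hw
    rw [hw]
    congr 1
    refine setIntegral_congr_fun measurableSet_Ioo fun x hx => ?_
    simp only [indicator_of_mem (hsub hx)]
  obtain ⟨k₁, hk₁⟩ := main (a₁ - δ) a₁ (by linarith) subset_union_left
  obtain ⟨k₄, hk₄⟩ := main a₂ (a₂ + δ) (by linarith) subset_union_right
  refine ⟨S.indicator g₀, k₁, k₄, hg, hg2, fun x hx => indicator_of_notMem (fun hx' => ?_) _,
    hk₁, hk₄⟩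
  rcases hx' with hx' | hx'
  · linarith [hx'.2, hx.1]
  · linarith [hx'.1, hx.2]

/-! ### Functions with a jump at the origin -/

theorem AssumptionB.exists_bound_deriv {a₁ a₂ : ℝ} {f : ℝ → ℝ} (hf : AssumptionB a₁ a₂ f) :
    ∃ L : ℝ, 0 ≤ L ∧ ∀ x ∈ Ioo a₁ 0 ∪ Ioo 0 a₂, x ∈ Ioo a₁ a₂ →
      DifferentiableAt ℝ f x ∧ |deriv f x| ≤ L := by
  obtain ⟨-, -, N, hN, h1, h2, hd⟩ := hf
  obtain ⟨C, hC⟩ := hd 1 le_rfl hN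
  have hN0 : (N : WithTop ℕ∞) ≠ 0 := by exact_mod_cast (by omega : N ≠ 0)
  refine ⟨max C 0, le_max_right _ _, fun x hx hx' => ⟨?_, ?_⟩⟩
  · rcases hx with hx | hx
    · exact (h1.differentiableOn hN0).differentiableAt (Ioo_mem_nhds hx.1 hx.2)
    · exact (h2.differentiableOn hN0).differentiableAt (Ioo_mem_nhds hx.1 hx.2)
  · have hx0 : x ≠ 0 := by
      rcases hx with hx | hx
      · exact hx.2.ne
      · exact hx.1.ne'
    have := hC x hx' hx0
    rw [iteratedDeriv_one] at this
    exact this.trans (le_max_left _ _)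

theorem AssumptionB.continuousOn_deriv {a₁ a₂ : ℝ} {f : ℝ → ℝ} (hf : AssumptionB a₁ a₂ f) :
    ContinuousOn (deriv f) (Ioo a₁ 0 ∪ Ioo 0 a₂) := by
  obtain ⟨-, -, N, hN, h1, h2, -⟩ := hf
  have hN1 : (1 : WithTop ℕ∞) ≤ N := by exact_mod_cast hN
  exact (h1.continuousOn_deriv_of_isOpen isOpen_Ioo hN1).union_of_isOpen
    (h2.continuousOn_deriv_of_isOpen isOpen_Ioo hN1) isOpen_Ioo isOpen_Ioo

theorem eventually_mem_pieces {a₁ a₂ : ℝ} (ha₁ : a₁ < 0) (ha₂ : 0 < a₂) :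
    ∀ᶠ x in 𝓝[≠] (0 : ℝ), x ∈ Ioo a₁ 0 ∪ Ioo 0 a₂ ∧ x ∈ Ioo a₁ a₂ := by
  filter_upwards [self_mem_nhdsWithin, nhdsWithin_le_nhds (Ioo_mem_nhds ha₁ ha₂)] with x hx hx'
  refine ⟨?_, hx'⟩
  rcases lt_or_gt_of_ne hx with h | h
  · exact Or.inl ⟨hx'.1, h⟩
  · exact Or.inr ⟨h, hx'.2⟩

/-! ### Blow-up of the derivative of `Lu` for discontinuous `u` -/

theorem derivBlowsUp_nonlocalL {a₁ a₂ δ : ℝ} (ha₁ : a₁ < 0) (ha₂ : 0 < a₂) (hδ : 0 < δ)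
    {K : ℝ → ℝ} (hA1 : KernelA1 δ K) (hA2 : KernelA2 δ K) (hsing : SingularAtOrigin K)
    (hK2 : MemLp K 2 volume) {u : ℝ → ℝ} (hu : AssumptionB a₁ a₂ u)
    (hb : MemW12Collar a₁ a₂ δ u) : DerivBlowsUpAtZero (nonlocalL a₁ a₂ δ K u) := by
  have h12 : a₁ < a₂ := ha₁.trans ha₂
  obtain ⟨g, k₁, k₄, hg, hg2, hg0, hl, hr⟩ := exists_primitive_of_memW12Collar h12 hδ hb
  obtain ⟨L, hL0, hL⟩ := hu.exists_bound_deriv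
  have hcd := hu.continuousOn_deriv
  obtain ⟨l, r, hlr, hul, hur⟩ := hu.1
  set S := Ioo a₁ 0 ∪ Ioo 0 a₂ with hS
  have hSm : MeasurableSet S := measurableSet_Ioo.union measurableSet_Ioo
  have hSsub : S ⊆ Ioo a₁ a₂ :=
    union_subset (Ioo_subset_Ioo_right ha₂.le) (Ioo_subset_Ioo_left ha₁.le)
  set d := S.indicator (deriv u) with hd
  have hd2 : MemLp d 2 volume := by
    refine memLp_of_bdd_of_zero_off (a := a₁) (b := a₂) (M := L) 2
      ((aestronglyMeasurable_indicator_iff hSm).2 (hcd.aestronglyMeasurable hSm))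
      (fun x => ?_) fun x hx => indicator_of_notMem (fun h => hx (Ioo_subset_Icc_self (hSsub h))) _
    by_cases hx : x ∈ S
    · simp only [hd, hx, indicator_of_mem]; exact (hL x hx (hSsub hx)).2
    · simpa only [hd, hx, not_false_eq_true, indicator_of_notMem, abs_zero] using hL0
  have hV : ∀ x y, x ≤ y → (x ∈ Ioo a₁ 0 ∧ y ∈ Ioo a₁ 0 ∨ x ∈ Ioo 0 a₂ ∧ y ∈ Ioo 0 a₂) →
      u y - u x = ∫ t in x..y, d t := by
    intro x y hxy hp
    have hsub : ∀ t ∈ uIcc x y, t ∈ S := by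
      intro t ht
      rw [uIcc_of_le hxy] at ht
      exact hp.imp (fun h => ⟨h.1.1.trans_le ht.1, ht.2.trans_lt h.2.2⟩)
        (fun h => ⟨h.1.1.trans_le ht.1, ht.2.trans_lt h.2.2⟩)
    rw [← intervalIntegral.integral_eq_sub_of_hasDerivAt
      (fun t ht => (hL t (hsub t ht) (hSsub (hsub t ht))).1.hasDerivAt)
      ((hcd.mono hsub).intervalIntegrable)]
    exact intervalIntegral.integral_congr fun t ht => (indicator_of_mem (hsub t ht) _).symm
  obtain ⟨w, c₁, c₂, c₃, c₄, hw, hw2, hae, hV₂, hV₃⟩ := exists_piecewisePrimitive ha₁ ha₂ hg hg2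
    (fun x hx => hg0 x (Ioo_subset_Icc_self hx)) hd2 hV hl hr (Eventually.of_forall fun y _ => rfl)
  obtain ⟨rfl, rfl⟩ := constants_eq_limits ha₁ ha₂ hw hV₂ hV₃ hul hur
  have hu2 : MemLp ((Ioo (a₁ - δ) (a₂ + δ)).indicator u) 2 volume := by
    refine (memLp_congr_ae ?_).2 (memLp_indicator_piecewisePrimitive hw a₁ a₂ c₁ c₂ c₃ c₄
      (a₁ - δ) (a₂ + δ))
    filter_upwards [hae] with y hy
    by_cases h : y ∈ Ioo (a₁ - δ) (a₂ + δ)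
    · simp only [h, indicator_of_mem, hy h]
    · simp only [h, not_false_eq_true, indicator_of_notMem]
  obtain ⟨e, C, he⟩ := eventually_hasDerivAt_kernelConv_piecewisePrimitive hA1 hA2 hK2 hw hw2
    ha₁.ne ha₂.ne' c₁ c₂ c₃ c₄
  set β := ∫ z, K z with hβ
  -- Near `0`, `Lu = K * u - β u`, and `u'` is bounded.
  refine derivBlowsUpAtZero_of_hasDerivAt (s := c₃ - c₂) (e := fun x => e x - β * deriv u x)
    (C := C + |β| * L) (sub_ne_zero.2 hlr.symm) hsing ?_
  filter_upwards [he, eventually_mem_pieces ha₁ ha₂] with x hx hxS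
  obtain ⟨hdu, hLx⟩ := hL x hxS.1 hxS.2
  refine ⟨?_, ?_⟩
  · refine (abs_sub _ _).trans (add_le_add hx.1 ?_)
    rw [abs_mul]; gcongr
  · refine ((hx.2.sub (hdu.hasDerivAt.const_mul β)).congr_of_eventuallyEq ?_).congr_deriv (by ring)
    filter_upwards [Ioo_mem_nhds hxS.2.1 hxS.2.2] with y hy
    rw [nonlocalL_eq_kernelConv h12 hδ hA1 hK2 hu2 hy, kernelConv_indicator_congr hA1 hae hy]
    rfl

/-! ### Blow-up of the derivative of the solution for discontinuous `f` -/

/-- The function `(K * u - f) / ∫ K` represents `u` in `Ω` and inherits a jump from `f`; once it is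
known to be a piecewise primitive of an `L²` function, the singularity of `K * u` can be read off. -/
theorem derivBlowsUp_solution {a₁ a₂ δ : ℝ} (ha₁ : a₁ < 0) (ha₂ : 0 < a₂) (hδ : 0 < δ)
    {K : ℝ → ℝ} (hA1 : KernelA1 δ K) (hA2 : KernelA2 δ K) (hsing : SingularAtOrigin K)
    (hK2 : MemLp K 2 volume) {f b u : ℝ → ℝ} (hf : AssumptionB a₁ a₂ f)
    (hb : MemW12Collar a₁ a₂ δ b) (hu : IsSolution a₁ a₂ δ K f b u) :
    ∃ v : ℝ → ℝ, v =ᵐ[volume.restrict (domainΩ a₁ a₂ ∪ collarΩ a₁ a₂ δ)] u ∧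
      DerivBlowsUpAtZero v := by
  have h12 : a₁ < a₂ := ha₁.trans ha₂
  have hK := hA1.integrable
  have hK0 := hA1.nonneg
  obtain ⟨g, k₁, k₄, hg, hg2, hg0, hbl, hbr⟩ := exists_primitive_of_memW12Collar h12 hδ hb
  obtain ⟨L, hL0, hL⟩ := hf.exists_bound_deriv
  obtain ⟨⟨l, r, hlr, hfl, hfr⟩, ⟨Cf, hCf⟩, -⟩ := id hf
  have hβ := integral_kernel_pos hK hK0 hsing
  have hu2 : MemLp ((Ioo (a₁ - δ) (a₂ + δ)).indicator u) 2 volume := by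
    rw [memLp_indicator_iff_restrict measurableSet_Ioo, ← domain_union_collar_eq h12 hδ]
    exact hu.memLp
  set S := Ioo a₁ 0 ∪ Ioo 0 a₂ with hS
  have hSo : IsOpen S := isOpen_Ioo.union isOpen_Ioo
  have hSm : MeasurableSet S := hSo.measurableSet
  have hSsub : S ⊆ Ioo a₁ a₂ :=
    union_subset (Ioo_subset_Ioo_right ha₂.le) (Ioo_subset_Ioo_left ha₁.le)
  set F := kernelConv K ((Ioo (a₁ - δ) (a₂ + δ)).indicator u) with hF
  have hFc : Continuous F := continuous_kernelConv hK2 hu2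
  set CF := √(∫ y, K y ^ 2) * √(∫ y, (Ioo (a₁ - δ) (a₂ + δ)).indicator u y ^ 2) with hCF
  have hFb : ∀ x, |F x| ≤ CF := abs_kernelConv_le hK2 hu2
  set β := ∫ z, K z with hβdef
  -- The equation determines the good representative of `u` in `Ω`.
  set V : ℝ → ℝ := fun x => (F x - f x) / β with hVdef
  have huV : ∀ᵐ y, y ∈ Ioo a₁ a₂ → u y = V y := by
    have h := (ae_restrict_iff' (measurableSet_Ioo (a := a₁) (b := a₂))).1 hu.eq_source
    filter_upwards [h] with y hy hyI
    have h1 := hy hyI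
    rw [nonlocalL_eq_kernelConv h12 hδ hA1 hK2 hu2 hyI] at h1
    simp only [hVdef]
    rw [eq_div_iff hβ.ne']
    linarith
  have hub : ∀ᵐ y, y ∈ collarΩ a₁ a₂ δ → u y = b y :=
    (ae_restrict_iff' (measurableSet_Ioc.union measurableSet_Ico)).1 hu.eq_collar
  have hl : ∀ᵐ y, y ∈ Ioo (a₁ - δ) a₁ → u y = (∫ t in (0 : ℝ)..y, g t) + k₁ := by
    filter_upwards [hub, hbl] with y h1 h2 hy
    rw [h1 (Or.inl ⟨hy.1, hy.2.le⟩), h2 hy]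
  have hr : ∀ᵐ y, y ∈ Ioo a₂ (a₂ + δ) → u y = (∫ t in (0 : ℝ)..y, g t) + k₄ := by
    filter_upwards [hub, hbr] with y h1 h2 hy
    rw [h1 (Or.inr ⟨hy.1.le, hy.2⟩), h2 hy]
  -- `G` carries the boundary data; the remaining part `T` is constant on either side of `Ω`.
  set G : ℝ → ℝ := fun x => ∫ t in (0 : ℝ)..x, g t with hG
  have hGz : ∀ x ∈ Ioo a₁ a₂, G x = 0 := by
    intro x hx
    refine intervalIntegral.integral_zero_ae (Eventually.of_forall fun t ht => hg0 t ?_)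
    have h1 := uIoc_subset_uIcc ht
    exact uIcc_subset_Icc ⟨ha₁.le, ha₂.le⟩ (Ioo_subset_Icc_self hx) h1
  have hGm : AEStronglyMeasurable G volume :=
    (continuous_primitive_of_integrable hg).aestronglyMeasurable
  have hGb : ∀ x, |G x| ≤ ∫ t, |g t| := abs_primitive_le hg 0
  set T : ℝ → ℝ := fun x => (Iic a₁).indicator (fun _ => k₁) x + (Ici a₂).indicator (fun _ => k₄) x
    + S.indicator V x with hT
  have hTl : ∀ x ≤ a₁, T x = k₁ := by
    intro x hx
    have h1 : x ∉ Ici a₂ := fun h => by linarith [mem_Ici.1 h]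
    have h2 : x ∉ S := fun h => by linarith [(hSsub h).1]
    simp only [hT, indicator_of_mem (mem_Iic.2 hx), indicator_of_notMem h1, indicator_of_notMem h2,
      add_zero]
  have hTr : ∀ x, a₂ ≤ x → T x = k₄ := by
    intro x hx
    have h1 : x ∉ Iic a₁ := fun h => by linarith [mem_Iic.1 h]
    have h2 : x ∉ S := fun h => by linarith [(hSsub h).2]
    simp only [hT, indicator_of_mem (mem_Ici.2 hx), indicator_of_notMem h1, indicator_of_notMem h2,
      add_zero, zero_add]
  have hTV : ∀ x ∈ S, T x = V x := by
    intro x hx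
    have h1 : x ∉ Iic a₁ := fun h => by linarith [mem_Iic.1 h, (hSsub hx).1]
    have h2 : x ∉ Ici a₂ := fun h => by linarith [mem_Ici.1 h, (hSsub hx).2]
    simp only [hT, indicator_of_mem hx, indicator_of_notMem h1, indicator_of_notMem h2, zero_add]
  have hfc : ContinuousOn f S := fun x hx =>
    (hL x hx (hSsub hx)).1.continuousAt.continuousWithinAt
  have hVc : ContinuousOn V S := (hFc.continuousOn.sub hfc).div_const β
  have hTm : AEStronglyMeasurable T volume :=
    (((measurable_const.indicator measurableSet_Iic).aestronglyMeasurable).add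
      ((measurable_const.indicator measurableSet_Ici).aestronglyMeasurable)).add
      ((aestronglyMeasurable_indicator_iff hSm).2 (hVc.aestronglyMeasurable hSm))
  have hTb : ∀ x, |T x| ≤ |k₁| + |k₄| + (CF + Cf) / β := by
    have hpos : 0 ≤ (CF + Cf) / β := by
      have h1 : 0 ≤ Cf := (abs_nonneg _).trans (hCf 0 ⟨ha₁, ha₂⟩)
      positivity
    intro x
    refine (abs_add_le _ _).trans (add_le_add ((abs_add_le _ _).trans (add_le_add ?_ ?_)) ?_)
    · exact norm_indicator_le_norm_self (fun _ => k₁) x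
    · exact norm_indicator_le_norm_self (fun _ => k₄) x
    · by_cases hx : x ∈ S
      · rw [indicator_of_mem hx, hVdef]
        simp only
        rw [abs_div, abs_of_pos hβ]
        gcongr
        exact (abs_sub _ _).trans (add_le_add (hFb x) (hCf x (hSsub hx)))
      · rw [indicator_of_notMem hx, abs_zero]; exact hpos
  have hne0 : ∀ c : ℝ, ∀ᵐ y, y ≠ c := fun c => Measure.ae_ne volume c
  have huT : ∀ᵐ y, y ∈ Ioo (a₁ - δ) (a₂ + δ) → u y = G y + T y := by
    filter_upwards [hl, hr, huV, hne0 a₁, hne0 a₂, hne0 0] with y h1 h2 h3 n1 n2 n0 hy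
    rcases lt_or_gt_of_ne n1 with hy1 | hy1
    · rw [h1 ⟨hy.1, hy1⟩, hTl y hy1.le]
    rcases lt_or_gt_of_ne n2 with hy2 | hy2
    · have hyS : y ∈ S := by
        rcases lt_or_gt_of_ne n0 with h | h
        · exact Or.inl ⟨hy1, h⟩
        · exact Or.inr ⟨h, hy2⟩
      rw [h3 ⟨hy1, hy2⟩, hTV y hyS, hGz y ⟨hy1, hy2⟩, zero_add]
    · rw [h2 ⟨hy2, hy.2⟩, hTr y hy2.le]
  have hFdec : ∀ x ∈ Ioo a₁ a₂, F x = kernelConv K G x + kernelConv K T x := by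
    intro x hx
    rw [hF, kernelConv_indicator_congr hA1 huT hx, kernelConv_add_of_bdd hK hGm hGb hTm hTb]
  set H : ℝ → ℝ := fun x => kernelConv K G x - f x with hH
  have heq : ∀ x ∈ Ioo a₁ 0 ∪ Ioo 0 a₂, β * T x = kernelConv K T x + H x := by
    intro x hx
    rw [hTV x hx]
    simp only [hVdef, hH]
    rw [mul_div_cancel₀ _ hβ.ne', hFdec x (hSsub hx)]
    ring
  set Cg := √(∫ y, K y ^ 2) * √(∫ y, g y ^ 2) with hCg
  have hLip : ∀ s t, Ioo s t ⊆ S → ∀ x ∈ Ioo s t, ∀ y ∈ Ioo s t,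
      |H y - H x| ≤ (Cg + L) * |y - x| := by
    intro s t hst x hx y hy
    have h1 : |kernelConv K G y - kernelConv K G x| ≤ Cg * |y - x| := by
      rw [hG, kernelConv_primitive_sub hK hg]
      exact intervalIntegral.norm_integral_le_of_norm_le_const (f := kernelConv K g)
        (C := Cg) fun z _ =>
        abs_kernelConv_le hK2 hg2 z
    have h2 : |f y - f x| ≤ L * |y - x| :=
      (convex_Ioo s t).norm_image_sub_le_of_norm_deriv_le
        (fun z hz => (hL z (hst hz) (hSsub (hst hz))).1)
        (fun z hz => (hL z (hst hz) (hSsub (hst hz))).2) hx hy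
    have e : H y - H x = (kernelConv K G y - kernelConv K G x) - (f y - f x) := by
      simp only [hH]; ring
    rw [e, add_mul]
    exact (abs_sub _ _).trans (add_le_add h1 h2)
  obtain ⟨d, hd2, hd⟩ := exists_L2_derivative hK hK0 hsing hK2 ha₁ ha₂ hTm hTb hTl hTr heq
    (by positivity) (hLip a₁ 0 subset_union_left) (hLip 0 a₂ subset_union_right)
    (fun x hx => (hVc.continuousAt (hSo.mem_nhds hx)).congr
      (by filter_upwards [hSo.mem_nhds hx] with y hy using (hTV y hy).symm))
  have hdV : ∀ x y, x ≤ y → (x ∈ Ioo a₁ 0 ∧ y ∈ Ioo a₁ 0 ∨ x ∈ Ioo 0 a₂ ∧ y ∈ Ioo 0 a₂) →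
      V y - V x = ∫ t in x..y, d t := by
    intro x y hxy hp
    rw [← hd x y hxy hp, hTV y (hp.imp And.right And.right), hTV x (hp.imp And.left And.left)]
  obtain ⟨w, c₁, c₂, c₃, c₄, hw, hw2, hae, hV₂, hV₃⟩ := exists_piecewisePrimitive ha₁ ha₂ hg hg2
    (fun x hx => hg0 x (Ioo_subset_Icc_self hx)) hd2 hdV hl hr huV
  have hVlim : ∀ {s : Filter ℝ} {m : ℝ}, s ≤ 𝓝 0 → Tendsto f s (𝓝 m) →
      Tendsto V s (𝓝 ((F 0 - m) / β)) := fun hs hm =>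
    (((hFc.tendsto 0).mono_left hs).sub hm).div_const β
  obtain ⟨hc₂, hc₃⟩ := constants_eq_limits ha₁ ha₂ hw hV₂ hV₃ (hVlim nhdsWithin_le_nhds hfl)
    (hVlim nhdsWithin_le_nhds hfr)
  have hjump : c₃ - c₂ ≠ 0 := by
    rw [hc₂, hc₃, ← sub_div]
    exact div_ne_zero (fun h => hlr (by linarith)) hβ.ne'
  obtain ⟨e, C, he⟩ := eventually_hasDerivAt_kernelConv_piecewisePrimitive hA1 hA2 hK2 hw hw2
    ha₁.ne ha₂.ne' c₁ c₂ c₃ c₄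
  refine ⟨(Ioo a₁ a₂).piecewise V u, ?_, ?_⟩
  · refine ae_restrict_of_ae ?_
    filter_upwards [huV] with y hy
    by_cases hyI : y ∈ Ioo a₁ a₂
    · rw [piecewise_eq_of_mem _ _ _ hyI, hy hyI]
    · rw [piecewise_eq_of_notMem _ _ _ hyI]
  refine derivBlowsUpAtZero_of_hasDerivAt (s := (c₃ - c₂) / β) (e := fun x => (e x - deriv f x) / β)
    (C := (C + L) / β) (div_ne_zero hjump hβ.ne') hsing ?_
  filter_upwards [he, eventually_mem_pieces ha₁ ha₂] with x hx hxS
  obtain ⟨hdf, hLx⟩ := hL x hxS.1 hxS.2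
  refine ⟨?_, ?_⟩
  · rw [abs_div, abs_of_pos hβ]
    gcongr
    exact (abs_sub _ _).trans (add_le_add hx.1 hLx)
  · refine (((hx.2.sub hdf.hasDerivAt).div_const β).congr_of_eventuallyEq ?_).congr_deriv (by ring)
    filter_upwards [Ioo_mem_nhds hxS.2.1 hxS.2.2] with y hy
    rw [piecewise_eq_of_mem _ _ _ hy]
    simp only [hVdef, hF, Pi.sub_apply]
    rw [kernelConv_indicator_congr hA1 hae hy]

theorem mainTheorem2 (a₁ a₂ δ : ℝ) (ha₁ : a₁ < 0) (ha₂ : 0 < a₂) (hδ : 0 < δ)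
    (K : ℝ → ℝ) (hA1 : KernelA1 δ K) (hA2 : KernelA2 δ K)
    (hsing : SingularAtOrigin K) (hK2 : MemLp K 2 volume) :
    (∀ f b u : ℝ → ℝ, AssumptionB a₁ a₂ f → MemW12Collar a₁ a₂ δ b →
      IsSolution a₁ a₂ δ K f b u →
      ∃ v : ℝ → ℝ, v =ᵐ[volume.restrict (domainΩ a₁ a₂ ∪ collarΩ a₁ a₂ δ)] u ∧
        DerivBlowsUpAtZero v) ∧
    (∀ u : ℝ → ℝ, AssumptionB a₁ a₂ u → MemW12Collar a₁ a₂ δ u →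
      DerivBlowsUpAtZero (nonlocalL a₁ a₂ δ K u)) :=
  ⟨fun _ _ _ hf hb hu => derivBlowsUp_solution ha₁ ha₂ hδ hA1 hA2 hsing hK2 hf hb hu,
    fun _ hu hb => derivBlowsUp_nonlocalL ha₁ ha₂ hδ hA1 hA2 hsing hK2 hu hb⟩
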